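/- Let $n\ge 1$, let $M_n=M_n(\mathbb C)$, let $D_n\subseteq M_n$ be the subalgebra of diagonal matrices, and let $\mathrm{Aut}(M_n,D_n)$ be the topological group (with the topology of pointwise convergence) of all $*$-automorphisms $\varphi$ of $M_n$ with $\varphi(D_n)=D_n$. Let $T$ be a locally compact Hausdorff space and let $A$ be an $n$-homogeneous C*-algebra over $T$, that is, a C*-algebra all of whose irreducible representations have dimension $n$, together with a homeomorphism $t\mapsto I_t$ from $T$ onto the primitive ideal space of $A$ with the hull-kernel topology. A Cartan subalgebra of $A$ is an abelian sub-C*-algebra $B\subseteq A$ that contains an approximate unit of $A$, is maximal abelian, is regular (the set of all $x\in A$ with $xBx^*\subseteq B$ and $x^*Bx\subseteq B$ generates $A$ as a C*-algebra), and is the range of a faithful conditional expectation $A\to B$. For a Cartan subalgebra $B$, let $\beta_B$ be the space of all pairs $(t,\varphi)$ where $t\in T$ and $\varphi:A\to M_n$ is a surjective $*$-homomorphism with kernel $I_t$ and $\varphi(B)=D_n$ (equivalently, an isomorphism from the fibre $A/I_t$ to $M_n$ that maps the fibre of $B$ onto $D_n$), with the topology of convergence of $t$ in $T$ and of $\varphi(a)$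 in $M_n$ for each $a\in A$, the projection $(t,\varphi)\mapsto t$, and the action of $\mathrm{Aut}(M_n,D_n)$ by composition. Let $B_1$ and $B_2$ be Cartan subalgebras of $A$. Then $\beta_1=\beta_{B_1}$ and $\beta_2=\beta_{B_2}$ are locally trivial principal $\mathrm{Aut}(M_n,D_n)$-bundles over $T$. Moreover, there is a $*$-automorphism $\Phi$ of $A$ with $\Phi(B_1)=B_2$ (that is, $(A,B_1)\cong(A,B_2)$) if and only if $\beta_1\cong\beta_2$ as principal $\mathrm{Aut}(M_n,D_n)$-bundles, where an isomorphism of principal bundles is an equivariant homeomorphism of the total spaces covering a homeomorphism of $T$ that need not be the identity. -/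

import Mathlib

open Topology

universe u v

noncomputable section

namespace HomCartan

/-! ### Representations, primitive ideals, homogeneous C*-algebras -/

section Representations

variable {A : Type u} [NonUnitalCStarAlgebra A]

/-- A `*`-representation on a Hilbert space is irreducible if it is nonzero and has no closed
invariant subspaces besides the trivial ones. -/
structure IsIrreducibleRep {H : Type u} [NormedAddCommGroup H] [InnerProductSpace ℂ H]
    [CompleteSpace H] (π : A →⋆ₙₐ[ℂ] (H →L[ℂ] H)) : Prop where
  ne_zero : π ≠ 0
  eq_bot_or_eq_top : ∀ K : Submodule ℂ H, IsClosed (K : Set H) →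
    (∀ (a : A), ∀ v ∈ K, π a v ∈ K) → K = ⊥ ∨ K = ⊤

variable (A) in
/-- `A` is `n`-homogeneous if all its irreducible representations have dimension `n`.
(Irreducible representations are cyclic, so Hilbert spaces in the universe of `A` suffice.) -/
def IsHomogeneous (n : ℕ) : Prop :=
  ∀ (H : Type u) [NormedAddCommGroup H] [InnerProductSpace ℂ H] [CompleteSpace H]
    (π : A →⋆ₙₐ[ℂ] (H →L[ℂ] H)), IsIrreducibleRep π → Module.finrank ℂ H = n

/-- A primitive ideal is the kernel of an irreducible representation. -/
def IsPrimitiveIdeal (I : TwoSidedIdeal A) : Prop :=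
  ∃ (H : Type u) (_ : NormedAddCommGroup H) (_ : InnerProductSpace ℂ H) (_ : CompleteSpace H)
    (π : A →⋆ₙₐ[ℂ] (H →L[ℂ] H)), IsIrreducibleRep π ∧ I = TwoSidedIdeal.ker π

variable (A) in
/-- The primitive ideal space of `A`. For an `n`-homogeneous C*-algebra this is its spectrum. -/
def PrimitiveSpectrum : Type u := {I : TwoSidedIdeal A // IsPrimitiveIdeal I}

/-- The hull-kernel (Jacobson) topology: the closed sets are the hulls `{P | S ⊆ P}` of subsets
`S` of `A`, that is, the intersections of the sets `{P | a ∈ P}`. -/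
instance : TopologicalSpace (PrimitiveSpectrum A) :=
  TopologicalSpace.generateFrom (Set.range fun a : A => {P : PrimitiveSpectrum A | a ∉ P.1})

end Representations

/-! ### Cartan subalgebras -/

section Cartan

variable {A : Type u} [NonUnitalCStarAlgebra A]

/-- `E` is a conditional expectation of `A` onto `B`: a positive contractive linear projection
of `A` onto `B` that is a `B`-bimodule map. -/
structure IsConditionalExpectation (B : NonUnitalStarSubalgebra ℂ A) (E : A →ₗ[ℂ] A) : Prop where
  map_mem : ∀ a, E a ∈ B
  map_of_mem : ∀ b ∈ B, E b = b
  map_mul_mul : ∀ b ∈ B, ∀ b' ∈ B, ∀ a, E (b * a * b') = b * E a * b'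
  positive : ∀ a, ∃ c : A, E (star a * a) = star c * c
  contractive : ∀ a, ‖E a‖ ≤ ‖a‖

/-- The normalizer `{x | x B x* ⊆ B and x* B x ⊆ B}` of `B` in `A`. -/
def normalizer (B : NonUnitalStarSubalgebra ℂ A) : Set A :=
  {x | ∀ b ∈ B, x * b * star x ∈ B ∧ star x * b * x ∈ B}

/-- Cartan subalgebras: closed abelian `*`-subalgebras that contain an approximate unit of `A`,
are maximal abelian (equal to their relative commutant), regular (their normalizer generates `A`
as a C*-algebra), and the image of a faithful conditional expectation. -/
structure IsCartanSubalgebra (B : NonUnitalStarSubalgebra ℂ A) : Prop where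
  isClosed : IsClosed (B : Set A)
  approximateUnit : ∃ l : Filter A, l.IsApproximateUnit ∧ (B : Set A) ∈ l
  maximalAbelian : ∀ a : A, a ∈ B ↔ ∀ b ∈ B, a * b = b * a
  regular : closure (NonUnitalStarAlgebra.adjoin ℂ (normalizer B) : Set A) = Set.univ
  expectation : ∃ E : A →ₗ[ℂ] A, IsConditionalExpectation B E ∧ ∀ a, E (star a * a) = 0 → a = 0

/-- `(A₁, B₁) ≅ (A₂, B₂)`: there is an isomorphism of C*-algebras `A₁ → A₂` mapping `B₁`
onto `B₂`. -/
def PairIso {A₁ A₂ : Type*} [NonUnitalCStarAlgebra A₁] [NonUnitalCStarAlgebra A₂]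
    (B₁ : NonUnitalStarSubalgebra ℂ A₁) (B₂ : NonUnitalStarSubalgebra ℂ A₂) : Prop :=
  ∃ φ : A₁ ≃⋆ₐ[ℂ] A₂, φ '' (B₁ : Set A₁) = (B₂ : Set A₂)

end Cartan

/-! ### Principal bundles -/

section Bundles

/-- `p : E → T` is a (locally trivial) principal `G`-bundle. The structure group is written as
acting on the left of the total space; a right action is turned into a left one by inversion. -/
structure IsPrincipalBundle (G : Type*) [Group G] [TopologicalSpace G] [IsTopologicalGroup G]
    {E T : Type*} [TopologicalSpace E] [TopologicalSpace T] [MulAction G E] (p : E → T) :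
    Prop where
  map_smul : ∀ (g : G) (x : E), p (g • x) = p x
  locallyTrivial : ∀ t : T, ∃ e : Bundle.Trivialization G p, t ∈ e.baseSet ∧
    ∀ (g : G) (x : E), p x ∈ e.baseSet → (e (g • x)).2 = g * (e x).2

/-- Isomorphism of principal `G`-bundles, allowed to induce a nontrivial homeomorphism of the
base. -/
def PrincipalBundleIso (G : Type*) [Group G] {E₁ E₂ T₁ T₂ : Type*}
    [TopologicalSpace E₁] [TopologicalSpace E₂] [TopologicalSpace T₁] [TopologicalSpace T₂]
    [MulAction G E₁] [MulAction G E₂] (p₁ : E₁ → T₁) (p₂ : E₂ → T₂) : Prop :=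
  ∃ (F : E₁ ≃ₜ E₂) (f : T₁ ≃ₜ T₂), (∀ x, p₂ (F x) = f (p₁ x)) ∧
    ∀ (g : G) (x : E₁), F (g • x) = g • F x

end Bundles

/-! ### The group `Aut(Mₙ, Dₙ)` -/

section Aut

/-- The C*-algebra `Mₙ` of complex `n × n` matrices. -/
abbrev M (n : ℕ) : Type := Matrix (Fin n) (Fin n) ℂ

/-- The set `Dₙ` of diagonal matrices. -/
def diag (n : ℕ) : Set (M n) := {x | x.IsDiag}

/-- The group `Aut(Mₙ, Dₙ)` of the `*`-automorphisms `φ` of `Mₙ` with `φ(Dₙ) = Dₙ`. -/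
def autMD (n : ℕ) : Subgroup (M n ≃⋆ₐ[ℂ] M n) where
  carrier := {φ | φ '' diag n = diag n}
  mul_mem' := by
    intro φ ψ hφ hψ
    have : (⇑(φ * ψ) : M n → M n) = φ ∘ ψ := rfl
    simp only [Set.mem_ofPred_eq] at *
    rw [this, Set.image_comp, hψ, hφ]
  one_mem' := by
    have : (⇑(1 : M n ≃⋆ₐ[ℂ] M n) : M n → M n) = id := rfl
    simp [this]
  inv_mem' := by
    intro φ hφ
    have : (⇑(φ⁻¹) : M n → M n) ∘ φ = id := funext fun x => φ.symm_apply_apply x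
    simp only [Set.mem_ofPred_eq] at *
    conv_lhs => rw [← hφ]
    rw [← Set.image_comp, this, Set.image_id]

/-- The topology of pointwise convergence. As `Mₙ` is finite dimensional, it is also the norm
topology. -/
instance (n : ℕ) : TopologicalSpace (autMD n) :=
  TopologicalSpace.induced (fun (φ : autMD n) (x : M n) => φ.1 x) inferInstance

theorem autMD_continuous_apply (n : ℕ) (x : M n) : Continuous fun φ : autMD n => φ.1 x :=
  (continuous_apply x).comp continuous_induced_dom

theorem autMD_continuous_iff {n : ℕ} {X : Type*} [TopologicalSpace X] {f : X → autMD n} :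
    Continuous f ↔ ∀ x : M n, Continuous fun s => (f s).1 x :=
  continuous_induced_rng.trans continuous_pi_iff

/-- The matrix of `φ` as a linear map in the basis of matrix units. -/
def autMat {n : ℕ} (φ : autMD n) : Matrix (Fin n × Fin n) (Fin n × Fin n) ℂ :=
  Matrix.of fun p q => φ.1 (Matrix.single q.1 q.2 1) p.1 p.2

theorem autMD_apply {n : ℕ} (φ : autMD n) (x : M n) (p : Fin n × Fin n) :
    φ.1 x p.1 p.2 = (autMat φ).mulVec (fun q => x q.1 q.2) p := by
  conv_lhs => rw [Matrix.matrix_eq_sum_single x]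
  have h : ∀ i j, Matrix.single i j (x i j) = x i j • Matrix.single i j (1 : ℂ) := by
    intro i j; simp
  simp only [h, map_sum, map_smul, Matrix.sum_apply, Matrix.smul_apply, smul_eq_mul,
    Matrix.mulVec, dotProduct, autMat, Matrix.of_apply, Fintype.sum_prod_type]
  exact Finset.sum_congr rfl fun i _ => Finset.sum_congr rfl fun j _ => mul_comm _ _

theorem autMat_inv_mul {n : ℕ} (φ : autMD n) : autMat φ⁻¹ * autMat φ = 1 := by
  ext p q
  have h := autMD_apply φ⁻¹ (φ.1 (Matrix.single q.1 q.2 1)) p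
  have h' : (φ⁻¹).1 (φ.1 (Matrix.single q.1 q.2 1)) = Matrix.single q.1 q.2 1 :=
    φ.1.symm_apply_apply _
  rw [h'] at h
  change (autMat φ⁻¹).mulVec (fun r => autMat φ r q) p = _
  have : (fun r => autMat φ r q) = fun r => φ.1 (Matrix.single q.1 q.2 1) r.1 r.2 := rfl
  rw [this, ← h]
  simp [Matrix.single_apply, Matrix.one_apply, Prod.ext_iff, eq_comm]

theorem continuous_autMat (n : ℕ) : Continuous (autMat : autMD n → _) :=
  continuous_matrix fun p q =>
    (autMD_continuous_apply n (Matrix.single q.1 q.2 1)).matrix_elem p.1 p.2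

theorem autMD_continuous_of_autMat {n : ℕ} {X : Type*} [TopologicalSpace X] {f : X → autMD n}
    (hf : Continuous fun s => autMat (f s)) : Continuous f := by
  rw [autMD_continuous_iff]
  intro x
  refine continuous_matrix fun i j => ?_
  simp only [fun s => autMD_apply (f s) x (i, j)]
  exact (continuous_pi_iff.1 (hf.matrix_mulVec continuous_const)) (i, j)

instance (n : ℕ) : IsTopologicalGroup (autMD n) where
  continuous_mul := by
    refine autMD_continuous_of_autMat ?_
    have : (fun s : autMD n × autMD n => autMat (s.1 * s.2)) =
        fun s => autMat s.1 * autMat s.2 := by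
      funext s
      ext p q
      exact autMD_apply s.1 (s.2.1 (Matrix.single q.1 q.2 1)) p
    rw [this]
    exact ((continuous_autMat n).comp continuous_fst).matrix_mul
      ((continuous_autMat n).comp continuous_snd)
  continuous_inv := by
    refine autMD_continuous_of_autMat ?_
    have : (fun φ : autMD n => autMat φ⁻¹) =
        fun φ => (autMat φ).det⁻¹ • (autMat φ).adjugate := by
      funext φ
      rw [← Ring.inverse_eq_inv', ← Matrix.inv_def]
      exact (Matrix.inv_eq_left_inv (autMat_inv_mul φ)).symm
    rw [this]
    refine Continuous.smul (Continuous.inv₀ (continuous_autMat n).matrix_det fun φ h => ?_)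
      (continuous_autMat n).matrix_adjugate
    have := congrArg Matrix.det (autMat_inv_mul φ)
    simp [h] at this

end Aut

/-! ### The principal bundle of a Cartan subalgebra -/

section Frames

variable {A : Type u} [NonUnitalCStarAlgebra A] {T : Type v} [TopologicalSpace T]

/-- Let `A` be a C*-algebra with primitive ideal space `T`, and `B` a `*`-subalgebra. The fibre
over `t` of the C*-bundle of `A` is the quotient of `A` by the primitive ideal `t`, and the fibre
of the bundle of `B` is the image of `B` in it. A point over `t` of the total space of the
associated bundle consists of an isomorphism from the fibre at `t` to `Mₙ` that maps the fibre of
`B` onto `Dₙ`; it is given here as a surjection `A → Mₙ` with kernel `t`. -/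
@[ext]
structure Frame (θ : T ≃ₜ PrimitiveSpectrum A) (n : ℕ) (B : NonUnitalStarSubalgebra ℂ A) where
  base : T
  hom : A →⋆ₙₐ[ℂ] M n
  ker_hom : TwoSidedIdeal.ker hom = (θ base).1
  surjective : Function.Surjective hom
  image_eq : hom '' (B : Set A) = diag n

variable {θ : T ≃ₜ PrimitiveSpectrum A} {n : ℕ} {B : NonUnitalStarSubalgebra ℂ A}

/-- The total space has the topology of convergence in the base together with convergence in `Mₙ`
on all sections, that is, on all elements of `A`. -/
instance : TopologicalSpace (Frame θ n B) :=
  TopologicalSpace.induced (fun x => (x.base, fun a : A => x.hom a)) inferInstance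

/-- `Aut(Mₙ, Dₙ)` acts on the total space by composition. -/
instance : MulAction (autMD n) (Frame θ n B) where
  smul g x :=
    { base := x.base
      hom := g.1.toNonUnitalStarAlgHom.comp x.hom
      ker_hom := by
        rw [← x.ker_hom]
        ext a
        simp only [TwoSidedIdeal.mem_ker]
        exact map_eq_zero_iff g.1 g.1.injective
      surjective := g.1.surjective.comp x.surjective
      image_eq := by
        change (fun a => g.1 (x.hom a)) '' (B : Set A) = diag n
        rw [← Set.image_image, x.image_eq]
        exact g.2 }
  one_smul _ := rfl
  mul_smul _ _ _ := rfl

variable (θ n B) in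
/-- The projection of the bundle associated with `B`. -/
def frameProj (x : Frame θ n B) : T := x.base

end Frames

end HomCartan

end

/-! By homogeneity, every nonzero `*`-homomorphism `A → Mₙ` is surjective with primitive kernel, and
every primitive ideal arises this way. Two such homomorphisms with the same kernel differ by an
automorphism of `Mₙ`. So `T` is studied through the space `Rep θ n` of these homomorphisms. It is
locally controlled by compactness: for `ε > 0`, the homomorphisms with `ε ≤ ‖φ a‖` form a compact
set for pointwise convergence (`Rep.isCompact_le_norm`). Hence `T` carries the quotient topology
(`Rep.isQuotientMap_base`), fibre norms are continuous on `T`, and, since irreducible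
representations separate points, norms in `A` are suprema of fibre norms.

Functional calculus lifts matrix units from one fibre to nearby fibres (`exists_local_frame`).
Summing an element of small support over matrix units gives elements that are scalar in every fibre:
bump functions and partitions of unity on `T`. Being central, these lie in every Cartan subalgebra
`B`, so a conditional expectation `E` onto `B` acts fibrewise (`Rep.hom_expectation_eq_zero`). Near
a point, `E` then shows that the fibres of `B` are spanned by the lifted minimal projections of the
fibre at that point. A matrix commuting with that fibre can therefore be lifted to an element
commuting with `B`, that is, to an element of `B`. So each fibre of `B` is maximal abelian in `Mₙ`,
hence conjugate to `Dₙ` (`exists_image_eq_diag`), and frames exist everywhere. Matrix units whose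
diagonal projections come from `B` normalize a local section of frames, and its continuity follows
from compactness; this is local triviality.

An automorphism with `Φ(B₁) = B₂` acts on frames by composition. Conversely, a bundle isomorphism
`F` turns `a : A` into the equivariant function `y ↦ (F⁻¹ y)(a)` on the frames of `B₂`. It is a
uniform limit of functions given by elements of `A`, patched by partitions of unity, so completeness
gives an element of `A` (`Frame.exists_hom_eq_comp`). This defines the automorphism, and membership
in a Cartan subalgebra can be read off from the frames (`Frame.mem_iff`). -/

noncomputable section

namespace HomCartan

/-! ### Existence of irreducible representations -/

section PureStates

open scoped ComplexOrder InnerProductSpace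

variable {C : Type u} [CStarAlgebra C]

/-- Normalized positive linear functionals bounded by `r`, as a set of functions. -/
def stateSet (C : Type u) [CStarAlgebra C] (r : ℝ) : Set (C → ℂ) :=
  {f | (∀ x y, f (x + y) = f x + f y) ∧ (∀ (c : ℂ) (x : C), f (c • x) = c * f x) ∧
    (∀ x, ‖f x‖ ≤ r * ‖x‖) ∧ (∀ x, 0 ≤ f (star x * x)) ∧ f 1 = 1}

/-- Tychonoff on a product of discs, since each defining condition is closed under pointwise
convergence. -/
theorem isCompact_stateSet (r : ℝ) : IsCompact (stateSet C r) := by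
  have hK : IsCompact (Set.univ.pi fun x : C => Metric.closedBall (0 : ℂ) (r * ‖x‖)) :=
    isCompact_univ_pi fun x => isCompact_closedBall _ _
  refine hK.of_isClosed_subset ?_ fun f hf x _ => by simpa using hf.2.2.1 x
  simp only [stateSet, Set.ofPred_and, Set.ofPred_forall]
  refine IsClosed.inter ?_ (IsClosed.inter ?_ (IsClosed.inter ?_ (IsClosed.inter ?_ ?_)))
  · exact isClosed_iInter fun x => isClosed_iInter fun y =>
      isClosed_eq (continuous_apply _) (by fun_prop)
  · exact isClosed_iInter fun x => isClosed_iInter fun y =>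
      isClosed_eq (continuous_apply _) (continuous_const.mul (continuous_apply _))
  · exact isClosed_iInter fun x => isClosed_le (continuous_apply _).norm continuous_const
  · exact isClosed_iInter fun x => isClosed_le continuous_const (continuous_apply _)
  · exact isClosed_eq (continuous_apply _) continuous_const

/-- A nonzero element is detected by a positive functional. -/
theorem exists_positive_functional {c : C} (hc : c ≠ 0) :
    ∃ f : C →L[ℂ] ℂ, (∀ x, 0 ≤ f (star x * x)) ∧ 0 < f (star c * c) := by
  let _ := CStarAlgebra.spectralOrder C
  have := CStarAlgebra.spectralOrderedRing C
  let P : ProperCone ℝ C :=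
    { carrier := {x | 0 ≤ x}
      add_mem' := fun {x y} (hx : 0 ≤ x) (hy : 0 ≤ y) => add_nonneg hx hy
      zero_mem' := le_refl (0 : C)
      smul_mem' := fun r x (hx : 0 ≤ x) => smul_nonneg (a := (r : ℝ)) r.2 hx
      isClosed' := isClosed_Ici (a := (0 : C)) }
  -- Hahn–Banach will separate this point from the closed positive cone.
  have hneg : -(star c * c) ∉ P := by
    intro h
    have h1 : (0 : C) ≤ -(star c * c) := h
    have h2 : star c * c = 0 := le_antisymm (by simpa using h1) (star_mul_self_nonneg c)
    exact hc (CStarRing.star_mul_self_eq_zero_iff c |>.1 h2)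
  obtain ⟨g, hg, hgc⟩ := P.hyperplane_separation_point hneg
  -- Symmetrizing makes `g' (i x)` vanish for self-adjoint `x`, so the complex extension is real
  -- there, with value `2 g x`.
  let g' : C →L[ℝ] ℝ := g + g.comp (starL' ℝ : C ≃L[ℝ] C).toContinuousLinearMap
  have hg' : ∀ x, g' x = g x + g (star x) := fun x => rfl
  have key : ∀ x : C, IsSelfAdjoint x → (StrongDual.extendRCLike (𝕜 := ℂ) g') x = (2 * g x : ℝ) := by
    intro x hx
    rw [StrongDual.extendRCLike_apply, hg', hg']
    simp [hx.star_eq, two_mul]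
  refine ⟨StrongDual.extendRCLike g', fun x => ?_, ?_⟩
  · rw [key _ (.star_mul_self x)]
    have := hg _ (show star x * x ∈ P from star_mul_self_nonneg x)
    exact_mod_cast mul_nonneg zero_le_two this
  · rw [key _ (.star_mul_self c)]
    have : 0 < g (star c * c) := by simpa using hgc
    exact_mod_cast mul_pos zero_lt_two this

/-- Dividing the functional by its value at `1` normalizes it. The bound `r` spares the proof that a
state has norm one; `1 ≤ r` is what later keeps vector states in the set. -/
theorem exists_mem_stateSet {c : C} (hc : c ≠ 0) :
    ∃ r, 1 ≤ r ∧ ∃ f ∈ stateSet C r, 0 < (f (star c * c)).re := by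
  obtain ⟨f, hf, hfc⟩ := exists_positive_functional hc
  let _ := CStarAlgebra.spectralOrder C
  have := CStarAlgebra.spectralOrderedRing C
  have hmono : ∀ x : C, 0 ≤ x → 0 ≤ f x := by
    intro x hx
    obtain ⟨y, rfl⟩ := CStarAlgebra.nonneg_iff_eq_star_mul_self.1 hx
    exact hf y
  have h1 : 0 < f 1 := by
    have h0 : 0 ≤ f 1 := by simpa using hf 1
    refine lt_of_le_of_ne h0 fun h => ?_
    -- If `f 1` were zero, positivity and `c*c ≤ ‖c*c‖ 1` would force `f (c*c) ≤ 0`.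
    have hle : star c * c ≤ algebraMap ℝ C ‖star c * c‖ :=
      IsSelfAdjoint.le_algebraMap_norm_self (.star_mul_self c)
    have := hmono _ (sub_nonneg.2 hle)
    rw [map_sub, Algebra.algebraMap_eq_smul_one, ← Complex.coe_smul, map_smul, ← h] at this
    simp at this
    exact absurd (lt_of_lt_of_le hfc this) (lt_irrefl _)
  have hinv : 0 < (f 1)⁻¹ := by
    rw [Complex.lt_def] at h1 ⊢
    have e : f 1 = ((f 1).re : ℂ) := Complex.ext rfl (by simpa using h1.2.symm)
    rw [e, ← Complex.ofReal_inv]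
    simpa using h1.1
  refine ⟨max 1 (‖(f 1)⁻¹‖ * ‖f‖), le_max_left _ _, fun x => (f 1)⁻¹ * f x,
    ⟨fun x y => ?_, fun a x => ?_, fun x => ?_, fun x => ?_, ?_⟩, ?_⟩
  · simp [mul_add]
  · simp only [map_smul, smul_eq_mul]; ring
  · rw [norm_mul]
    calc _ ≤ ‖(f 1)⁻¹‖ * (‖f‖ * ‖x‖) := by gcongr; exact f.le_opNorm x
      _ ≤ _ := by rw [← mul_assoc]; gcongr; exact le_max_right _ _
  · exact mul_nonneg hinv.le (hf x)
  · exact inv_mul_cancel₀ h1.ne'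
  · exact (Complex.lt_def.1 (mul_pos hinv hfc)).1

/-- A nonzero element is detected by an extreme point of a set of states. -/
theorem exists_extreme_state {c : C} (hc : c ≠ 0) :
    ∃ r, 1 ≤ r ∧ ∃ f ∈ (stateSet C r).extremePoints ℝ, f (star c * c) ≠ 0 := by
  obtain ⟨r, hr, f₀, hf₀, hpos⟩ := exists_mem_stateSet hc
  refine ⟨r, hr, ?_⟩
  have hcont : Continuous fun f : C → ℂ => (f (star c * c)).re :=
    Complex.continuous_re.comp (continuous_apply _)
  obtain ⟨f₁, hf₁, hmax⟩ := (isCompact_stateSet r).exists_isMaxOn ⟨f₀, hf₀⟩ hcont.continuousOn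
  -- The maximizers of `f ↦ Re f (c*c)` form a compact face, so an extreme point of `F` is extreme
  -- in the whole set.
  let F : Set (C → ℂ) := stateSet C r ∩ {f | (f (star c * c)).re = (f₁ (star c * c)).re}
  have hF : IsCompact F := (isCompact_stateSet r).inter_right (isClosed_eq hcont continuous_const)
  obtain ⟨f, hf⟩ := hF.extremePoints_nonempty ⟨f₁, hf₁, rfl⟩
  refine ⟨f, ⟨hf.1.1, fun g₁ hg₁ g₂ hg₂ hseg => ?_⟩, fun h0 => ?_⟩
  · have h1 := hmax hg₁
    have h2 := hmax hg₂
    simp only [Set.mem_ofPred_eq] at h1 h2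
    obtain ⟨a, b, ha, hb, hab, hfe⟩ := hseg
    have h3 : a * (g₁ (star c * c)).re + b * (g₂ (star c * c)).re = (f₁ (star c * c)).re := by
      rw [← hf.1.2, ← hfe]; simp
    refine hf.2 ⟨hg₁, ?_⟩ ⟨hg₂, ?_⟩ ⟨a, b, ha, hb, hab, hfe⟩
    · simp only [Set.mem_ofPred_eq]
      obtain rfl : b = 1 - a := by linarith
      nlinarith
    · simp only [Set.mem_ofPred_eq]
      obtain rfl : b = 1 - a := by linarith
      nlinarith
  · have := hmax hf₀
    simp only [Set.mem_ofPred_eq] at this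
    have h4 : (f (star c * c)).re = (f₁ (star c * c)).re := hf.1.2
    rw [h0, Complex.zero_re] at h4
    linarith

/-- The representation associated with an extreme state has a cyclic vector, and every closed
invariant subspace is trivial. -/
theorem exists_irreducible_of_extreme {r : ℝ} (hr : 1 ≤ r) {f : C → ℂ}
    (hf : f ∈ (stateSet C r).extremePoints ℝ) :
    ∃ (H : Type u) (_ : NormedAddCommGroup H) (_ : InnerProductSpace ℂ H) (_ : CompleteSpace H)
      (π : C →⋆ₐ[ℂ] (H →L[ℂ] H)) (ξ : H), (∀ x, f x = ⟪ξ, π x ξ⟫_ℂ) ∧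
      ∀ K : Submodule ℂ H, IsClosed (K : Set H) → (∀ (a : C), ∀ v ∈ K, π a v ∈ K) →
        K = ⊥ ∨ K = ⊤ := by
  let _ := CStarAlgebra.spectralOrder C
  have := CStarAlgebra.spectralOrderedRing C
  obtain ⟨⟨hadd, hsmul, hbd, hpos, hone⟩, hext⟩ := hf
  let fl : C →ₗ[ℂ] ℂ := { toFun := f, map_add' := hadd, map_smul' := hsmul }
  let p : C →ₚ[ℂ] ℂ := PositiveLinearMap.mk₀ fl fun x hx => by
    obtain ⟨y, rfl⟩ := CStarAlgebra.nonneg_iff_eq_star_mul_self.1 hx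
    exact hpos y
  have hp : ∀ x, p x = f x := fun x => rfl
  let π := p.gnsStarAlgHom
  let ξ : p.GNS := ((p.toPreGNS 1 : p.PreGNS) : p.GNS)
  have hπξ : ∀ x, π x ξ = ((p.toPreGNS x : p.PreGNS) : p.GNS) := by
    intro x
    change p.gnsNonUnitalStarAlgHom x ξ = _
    rw [PositiveLinearMap.gnsNonUnitalStarAlgHom_apply_coe]
    simp
  have hfξ : ∀ x, f x = ⟪ξ, π x ξ⟫_ℂ := by
    intro x
    rw [hπξ, UniformSpace.Completion.inner_coe, PositiveLinearMap.preGNS_inner_def]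
    simp [hp]
  have hdense : DenseRange fun x => π x ξ := by
    have : (fun x => π x ξ) = (fun y : p.PreGNS => (y : p.GNS)) ∘ p.toPreGNS := funext hπξ
    rw [this]
    exact UniformSpace.Completion.denseRange_coe.comp p.toPreGNS.surjective.denseRange
      (UniformSpace.Completion.continuous_coe _)
  refine ⟨p.GNS, inferInstance, inferInstance, inferInstance, π, ξ, hfξ, fun K hK hinv => ?_⟩
  have : CompleteSpace K := hK.completeSpace_coe
  have hξ1 : ‖ξ‖ = 1 := by
    have := hfξ 1
    rw [hone, map_one, one_apply_eq_self, inner_self_eq_norm_sq_to_K] at this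
    have h2 : ‖ξ‖ ^ 2 = 1 := by
      have h3 : ((‖ξ‖ ^ 2 : ℝ) : ℂ) = 1 := by simpa using this.symm
      exact_mod_cast h3
    nlinarith [norm_nonneg ξ]
  let P : p.GNS →L[ℂ] p.GNS := K.starProjection
  -- The orthogonal complement is invariant because the representation preserves adjoints; hence the
  -- projection `P` commutes with it.
  have hinv' : ∀ (a : C), ∀ v ∈ Kᗮ, π a v ∈ Kᗮ := by
    intro a v hv w hw
    rw [← ContinuousLinearMap.adjoint_inner_left, ← ContinuousLinearMap.star_eq_adjoint, ← map_star]
    exact hv _ (hinv _ _ hw)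
  have hcomm : ∀ a v, P (π a v) = π a (P v) := by
    intro a v
    refine Submodule.eq_starProjection_of_mem_orthogonal (hinv a _ ?_) ?_
    · exact Submodule.starProjection_apply_mem K v
    · rw [← map_sub]
      exact hinv' a _ (Submodule.sub_starProjection_mem_orthogonal v)
  have hvec : ∀ η : p.GNS, η ≠ 0 →
      (fun x => ((‖η‖ ^ 2 : ℝ) : ℂ)⁻¹ * ⟪η, π x η⟫_ℂ) ∈ stateSet C r := by
    intro η hη
    have hη' : 0 < ‖η‖ := norm_pos_iff.2 hη
    refine ⟨fun x y => ?_, fun a x => ?_, fun x => ?_, fun x => ?_, ?_⟩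
    · simp [inner_add_right, mul_add]
    · simp [inner_smul_right]; ring
    · rw [norm_mul, norm_inv, Complex.norm_real, Real.norm_of_nonneg (by positivity),
        inv_mul_le_iff₀ (by positivity)]
      calc ‖⟪η, π x η⟫_ℂ‖ ≤ ‖η‖ * ‖π x η‖ := norm_inner_le_norm _ _
        _ ≤ ‖η‖ * (‖x‖ * ‖η‖) := by
          gcongr
          exact ((π x).le_opNorm η).trans (by gcongr; exact NonUnitalStarAlgHom.norm_apply_le π x)
        _ = ‖η‖ ^ 2 * (1 * ‖x‖) := by ring
        _ ≤ _ := by gcongr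
    · have : ⟪η, π (star x * x) η⟫_ℂ = ((‖π x η‖ ^ 2 : ℝ) : ℂ) := by
        rw [map_mul, map_star, mul_apply_eq_comp, ContinuousLinearMap.star_eq_adjoint,
          ContinuousLinearMap.adjoint_inner_right, inner_self_eq_norm_sq_to_K]
        norm_cast
      simp only [this]
      rw [← Complex.ofReal_inv, ← Complex.ofReal_mul]
      exact Complex.zero_le_real.2 (by positivity)
    · beta_reduce
      rw [map_one, one_apply_eq_self, inner_self_eq_norm_sq_to_K]
      have : ((‖η‖ ^ 2 : ℝ) : ℂ) ≠ 0 := by exact_mod_cast (by positivity)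
      push_cast at this ⊢
      exact inv_mul_cancel₀ this
  have hall : ∀ Q : p.GNS →L[ℂ] p.GNS, (∀ a v, Q (π a v) = π a (Q v)) → Q ξ = 0 → ∀ v, Q v = 0 := by
    intro Q hQ hQξ
    have : (Q : p.GNS → p.GNS) = fun _ => 0 :=
      Continuous.ext_on hdense Q.continuous continuous_const (by
        rintro _ ⟨x, rfl⟩
        simp [hQ, hQξ])
    exact fun v => congrFun this v
  by_cases h0 : P ξ = 0
  · left
    rw [Submodule.eq_bot_iff]
    intro v hv
    have := hall P hcomm h0 v
    rwa [show P v = v from Submodule.starProjection_eq_self_iff.2 hv] at this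
  by_cases h1 : ξ - P ξ = 0
  · right
    rw [Submodule.eq_top_iff']
    intro v
    have := hall (1 - P) (fun a v => by simp [hcomm]) (by simpa using h1) v
    have h2 : P v = v := (sub_eq_zero.1 (by simpa using this)).symm
    exact Submodule.starProjection_eq_self_iff.1 h2
  -- For `P ξ` neither `0` nor `ξ`, `f` is a proper convex combination of the normalized vector
  -- states of `P ξ` and `ξ - P ξ`. Extremality identifies `f` with the first, cyclicity then gives
  -- `P ξ = ‖P ξ‖² ξ`, and applying `P` gives `‖P ξ‖ = 1`, contrary to `ξ - P ξ ≠ 0`.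
  exfalso
  have hs := hvec _ h0
  have hs' := hvec _ h1
  have hPm : P ξ ∈ K := Submodule.starProjection_apply_mem K ξ
  have hPo : ξ - P ξ ∈ Kᗮ := Submodule.sub_starProjection_mem_orthogonal ξ
  have hpyth : ‖P ξ‖ ^ 2 + ‖ξ - P ξ‖ ^ 2 = 1 := by
    have := norm_add_sq_eq_norm_sq_add_norm_sq_of_inner_eq_zero (𝕜 := ℂ) (P ξ) (ξ - P ξ) (hPo _ hPm)
    rw [add_sub_cancel, hξ1] at this
    nlinarith
  have hp1 : 0 < ‖P ξ‖ ^ 2 := by have := norm_pos_iff.2 h0; positivity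
  have hp2 : 0 < ‖ξ - P ξ‖ ^ 2 := by have := norm_pos_iff.2 h1; positivity
  have heq := hext hs hs' ⟨‖P ξ‖ ^ 2, ‖ξ - P ξ‖ ^ 2, hp1, hp2, hpyth, by
    funext x
    simp only [Pi.add_apply, Pi.smul_apply, Complex.real_smul]
    rw [mul_inv_cancel_left₀ (by exact_mod_cast hp1.ne'), mul_inv_cancel_left₀ (by exact_mod_cast hp2.ne'),
      hfξ]
    have e1 : ⟪P ξ, π x (ξ - P ξ)⟫_ℂ = 0 := hinv' x _ hPo _ hPm
    have e2 : ⟪ξ - P ξ, π x (P ξ)⟫_ℂ = 0 := by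
      rw [← inner_conj_symm, hPo _ (hinv x _ hPm), map_zero]
    have e3 : π x ξ = π x (P ξ) + π x (ξ - P ξ) := by rw [← map_add, add_sub_cancel]
    have e4 : ⟪ξ, π x ξ⟫_ℂ = ⟪P ξ, π x ξ⟫_ℂ + ⟪ξ - P ξ, π x ξ⟫_ℂ := by
      rw [← inner_add_left, add_sub_cancel]
    rw [e4, e3, inner_add_right, inner_add_right, e1, e2]
    simp⟩
  have hkey : ∀ x, ⟪P ξ - ((‖P ξ‖ ^ 2 : ℝ) : ℂ) • ξ, π x ξ⟫_ℂ = 0 := by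
    intro x
    have h5 := congrFun heq x
    simp only [hfξ] at h5
    rw [inv_mul_eq_iff_eq_mul₀ (by exact_mod_cast hp1.ne')] at h5
    have e5 : ⟪P ξ, π x (P ξ)⟫_ℂ = ⟪P ξ, π x ξ⟫_ℂ := by
      have e1 : ⟪P ξ, π x (ξ - P ξ)⟫_ℂ = 0 := hinv' x _ hPo _ hPm
      rw [map_sub, inner_sub_right, sub_eq_zero] at e1
      exact e1.symm
    rw [inner_sub_left, inner_smul_left, ← e5, h5]
    simp
  have hzero : P ξ - ((‖P ξ‖ ^ 2 : ℝ) : ℂ) • ξ = 0 :=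
    hdense.eq_zero_of_inner_left ℂ (by intro x; exact hkey x)
  have hPP : P (P ξ) = P ξ := Submodule.starProjection_eq_self_iff.2 hPm
  rw [sub_eq_zero] at hzero
  have h6 : P ξ = ((‖P ξ‖ ^ 2 : ℝ) : ℂ) • P ξ := by
    conv_lhs => rw [← hPP, hzero, map_smul]
  have h7 : ((‖P ξ‖ ^ 2 : ℝ) : ℂ) = 1 := by
    have : (1 - ((‖P ξ‖ ^ 2 : ℝ) : ℂ)) • P ξ = 0 := by rw [sub_smul, one_smul, ← h6, sub_self]
    rcases smul_eq_zero.1 this with h | h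
    · exact (sub_eq_zero.1 h).symm
    · exact absurd h h0
  have h8 : ‖P ξ‖ ^ 2 = 1 := by exact_mod_cast h7
  linarith

/-- Every nonzero element of a C*-algebra is nonzero in some irreducible representation. -/
theorem exists_irreducibleRep_ne_zero {A : Type u} [NonUnitalCStarAlgebra A] {a : A} (ha : a ≠ 0) :
    ∃ (H : Type u) (_ : NormedAddCommGroup H) (_ : InnerProductSpace ℂ H) (_ : CompleteSpace H)
      (π : A →⋆ₙₐ[ℂ] (H →L[ℂ] H)), IsIrreducibleRep π ∧ π a ≠ 0 := by
  have ha' : (a : Unitization ℂ A) ≠ 0 := by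
    rw [ne_eq, ← Unitization.inr_zero ℂ]
    exact fun h => ha (Unitization.inr_injective h)
  obtain ⟨r, hr, f, hf, hfa⟩ := exists_extreme_state ha'
  obtain ⟨H, i1, i2, i3, π, ξ, hfξ, hirr⟩ := exists_irreducible_of_extreme hr hf
  have hne : π (a : Unitization ℂ A) ≠ 0 := by
    intro h
    rw [hfξ, map_mul, h] at hfa
    simp at hfa
  let ρ : A →⋆ₙₐ[ℂ] (H →L[ℂ] H) :=
    (π : Unitization ℂ A →⋆ₙₐ[ℂ] (H →L[ℂ] H)).comp (Unitization.inrNonUnitalStarAlgHom ℂ A)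
  have hρ : ∀ x, ρ x = π (x : Unitization ℂ A) := fun x => rfl
  refine ⟨H, i1, i2, i3, ρ, ⟨fun h => hne ?_, fun K hK hinv => hirr K hK fun x v hv => ?_⟩, ?_⟩
  · rw [← hρ, h]; rfl
  · induction x using Unitization.ind with
    | inl_add_inr z y =>
      rw [map_add, add_apply]
      refine K.add_mem ?_ (hinv y v hv)
      have : (Unitization.inl z : Unitization ℂ A) = algebraMap ℂ _ z := rfl
      rw [this, AlgHomClass.commutes, Algebra.algebraMap_eq_smul_one]
      exact K.smul_mem z hv
  · exact hne

end PureStates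

/-! ### Finite-dimensional representations of homogeneous C*-algebras -/

section FiniteDimensional

/-- Burnside's theorem: an irreducible finite-dimensional representation is surjective. -/
theorem surjective_of_irreducible {R V : Type*} [Ring R] [Algebra ℂ R] [AddCommGroup V] [Module ℂ V]
    [FiniteDimensional ℂ V] [Nontrivial V] (f : R →ₐ[ℂ] Module.End ℂ V)
    (hf : ∀ K : Submodule ℂ V, (∀ r, ∀ v ∈ K, f r v ∈ K) → K = ⊥ ∨ K = ⊤) :
    Function.Surjective f := by
  let _ : Module R V := Module.compHom V f.toRingHom
  have hsmul : ∀ (r : R) (v : V), r • v = f r v := fun r v => rfl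
  have : IsScalarTower ℂ R V := ⟨fun c r v => by simp [hsmul]⟩
  have hs : IsSimpleModule R V := by
    rw [isSimpleModule_iff]
    refine @IsSimpleOrder.mk _ _ _ inferInstance fun K => ?_
    rcases hf (K.restrictScalars ℂ) (fun r v hv => K.smul_mem r hv) with h | h
    · left; exact (Submodule.restrictScalars_eq_bot_iff ℂ R V).1 h
    · right; exact (Submodule.restrictScalars_eq_top_iff ℂ R V).1 h
  -- Schur's lemma: an eigenspace of an intertwiner is invariant and nonzero, hence everything.
  have hschur : ∀ g : Module.End R V, ∃ c : ℂ, ∀ v, g v = c • v := by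
    intro g
    let g' : Module.End ℂ V := g.restrictScalars ℂ
    obtain ⟨c, hc⟩ := Module.End.exists_eigenvalue g'
    refine ⟨c, fun v => ?_⟩
    have hinv : ∀ r, ∀ v ∈ Module.End.eigenspace g' c, f r v ∈ Module.End.eigenspace g' c := by
      intro r v hv
      rw [Module.End.mem_eigenspace_iff] at hv ⊢
      have h1 : g (r • v) = r • g v := map_smul g r v
      change g (r • v) = c • (f r v)
      rw [h1, hsmul, show g v = c • v from hv, map_smul]
    rcases hf (Module.End.eigenspace g' c) hinv with h | h
    · exact absurd h hc
    · have : v ∈ Module.End.eigenspace g' c := h ▸ Submodule.mem_top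
      exact Module.End.mem_eigenspace_iff.1 this
  intro x
  -- Since the commutant is scalar, every `ℂ`-linear map commutes with it, and Jacobson density
  -- matches it on a finite spanning set.
  let F : Module.End (Module.End R V) V :=
    { toFun := x
      map_add' := map_add x
      map_smul' := fun g v => by
        obtain ⟨c, hc⟩ := hschur g
        simp [hc] }
  obtain ⟨s, hs'⟩ := Module.Finite.fg_top (R := ℂ) (M := V)
  obtain ⟨r, hr⟩ := jacobson_density F s
  refine ⟨r, LinearMap.ext_on hs' fun v hv => (hr v hv).symm⟩

variable {A : Type u} [NonUnitalCStarAlgebra A]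

open scoped InnerProductSpace

/-- Compression of a representation to a finite-dimensional invariant subspace. -/
def restrictRep {H : Type*} [NormedAddCommGroup H] [InnerProductSpace ℂ H] [FiniteDimensional ℂ H]
    (π : A →⋆ₙₐ[ℂ] (H →L[ℂ] H)) (K : Submodule ℂ H) (hK : ∀ a, ∀ v ∈ K, π a v ∈ K) :
    A →⋆ₙₐ[ℂ] (K →L[ℂ] K) where
  toFun a := K.orthogonalProjectionOnto ∘L π a ∘L K.subtypeL
  map_smul' c a := by ext; simp
  map_zero' := by ext; simp
  map_add' a b := by ext; simp
  map_mul' a b := by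
    ext v
    have h : (K.orthogonalProjectionOnto (π b v) : H) = π b v :=
      Submodule.starProjection_eq_self_iff.2 (hK b v v.2)
    simp [h]
  map_star' a := by
    rw [ContinuousLinearMap.star_eq_adjoint, ContinuousLinearMap.adjoint_comp,
      ContinuousLinearMap.adjoint_comp, map_star, ContinuousLinearMap.star_eq_adjoint,
      Submodule.adjoint_subtypeL, Submodule.adjoint_orthogonalProjectionOnto]
    rfl

theorem restrictRep_apply {H : Type*} [NormedAddCommGroup H] [InnerProductSpace ℂ H]
    [FiniteDimensional ℂ H] (π : A →⋆ₙₐ[ℂ] (H →L[ℂ] H)) (K : Submodule ℂ H)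
    (hK : ∀ a, ∀ v ∈ K, π a v ∈ K) (a : A) (v : K) : (restrictRep π K hK a v : H) = π a v :=
  Submodule.starProjection_eq_self_iff.2 (hK a v v.2)

/-- A finite-dimensional irreducible representation is equivalent to one on a Hilbert space in the
universe of the algebra. -/
theorem exists_isIrreducibleRep_of_finiteDimensional {K : Type*} [NormedAddCommGroup K]
    [InnerProductSpace ℂ K] [FiniteDimensional ℂ K] (ρ : A →⋆ₙₐ[ℂ] (K →L[ℂ] K)) (h0 : ρ ≠ 0)
    (hirr : ∀ L : Submodule ℂ K, (∀ a, ∀ v ∈ L, ρ a v ∈ L) → L = ⊥ ∨ L = ⊤) :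
    ∃ (H : Type u) (_ : NormedAddCommGroup H) (_ : InnerProductSpace ℂ H) (_ : CompleteSpace H)
      (π : A →⋆ₙₐ[ℂ] (H →L[ℂ] H)), IsIrreducibleRep π ∧
        Module.finrank ℂ H = Module.finrank ℂ K ∧ ∀ a, π a = 0 ↔ ρ a = 0 := by
  have : CompleteSpace K := FiniteDimensional.complete ℂ K
  let e : K ≃ₗᵢ[ℂ] EuclideanSpace ℂ (ULift.{u} (Fin (Module.finrank ℂ K))) :=
    ((stdOrthonormalBasis ℂ K).reindex Equiv.ulift.symm).repr
  let c := e.conjStarAlgEquiv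
  let π : A →⋆ₙₐ[ℂ] _ := c.toNonUnitalStarAlgHom.comp ρ
  have hπ : ∀ a v, π a v = e (ρ a (e.symm v)) := fun a v => rfl
  have hz : ∀ a, π a = 0 ↔ ρ a = 0 := fun a => map_eq_zero_iff c c.injective
  refine ⟨_, inferInstance, inferInstance, inferInstance, π, ⟨fun h => h0 ?_, fun L _ hL => ?_⟩,
    by simp, hz⟩
  · ext1 a; exact (hz a).1 (by rw [h]; rfl)
  · rcases hirr (L.comap (e.toLinearEquiv : K →ₗ[ℂ] _)) (fun a v hv => by
        have := hL a _ hv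
        simpa [hπ] using this) with h | h
    · left
      rw [Submodule.eq_bot_iff] at h ⊢
      intro x hx
      have := h (e.symm x) (by simpa using hx)
      simpa using this
    · right
      rw [Submodule.eq_top_iff'] at h ⊢
      intro x
      simpa using h (e.symm x)

/-- An invariant subspace of least dimension on which `π` is nonzero is irreducible. By homogeneity
its dimension is `n`, so it is the whole space. -/
theorem eq_bot_or_eq_top_of_isHomogeneous {n : ℕ} (hA : IsHomogeneous A n) {H : Type*}
    [NormedAddCommGroup H] [InnerProductSpace ℂ H] [FiniteDimensional ℂ H]
    (hH : Module.finrank ℂ H = n) (π : A →⋆ₙₐ[ℂ] (H →L[ℂ] H)) (h0 : π ≠ 0)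
    (L : Submodule ℂ H) (hL : ∀ a, ∀ v ∈ L, π a v ∈ L) : L = ⊥ ∨ L = ⊤ := by
  classical
  let Q : ℕ → Prop := fun k => ∃ K : Submodule ℂ H, (∀ a, ∀ v ∈ K, π a v ∈ K) ∧
    (∃ a, ∃ v ∈ K, π a v ≠ 0) ∧ Module.finrank ℂ K = k
  have hQ : ∃ k, Q k := by
    refine ⟨_, ⊤, fun _ _ _ => Submodule.mem_top, ?_, rfl⟩
    by_contra! h
    exact h0 (by ext a v; exact h a v Submodule.mem_top)
  obtain ⟨K, hK, ⟨a₀, v₀, hv₀, hne⟩, hrank⟩ := Nat.find_spec hQ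
  have hmin : ∀ L : Submodule ℂ H, L ≤ K → (∀ a, ∀ v ∈ L, π a v ∈ L) →
      (∃ a, ∃ v ∈ L, π a v ≠ 0) → L = K := by
    intro L hLK hL hne
    refine Submodule.eq_of_le_of_finrank_le hLK ?_
    rw [hrank]
    exact Nat.find_min' hQ ⟨L, hL, hne, rfl⟩
  have hirr : ∀ L : Submodule ℂ H, L ≤ K → (∀ a, ∀ v ∈ L, π a v ∈ L) → L = ⊥ ∨ L = K := by
    intro L hLK hL
    by_cases h : ∃ a, ∃ v ∈ L, π a v ≠ 0
    · exact Or.inr (hmin L hLK hL h)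
    left
    push Not at h
    have hperp : ∀ a, ∀ v ∈ Lᗮ ⊓ K, π a v ∈ Lᗮ ⊓ K := by
      intro a v hv
      refine ⟨fun w hw => ?_, hK a v hv.2⟩
      have : CompleteSpace H := FiniteDimensional.complete ℂ H
      rw [← ContinuousLinearMap.adjoint_inner_left, ← ContinuousLinearMap.star_eq_adjoint,
        ← map_star]
      exact hv.1 _ (hL _ _ hw)
    -- If `π` vanishes on `L`, it is nonzero on the complement of `L` in `K`, which by minimality is
    -- all of `K`.
    have hLP : Lᗮ ⊓ K = K := by
      refine hmin _ inf_le_right hperp ?_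
      by_contra! h'
      refine hne ?_
      have hm : v₀ - L.starProjection v₀ ∈ Lᗮ ⊓ K :=
        ⟨Submodule.sub_starProjection_mem_orthogonal v₀,
          K.sub_mem hv₀ (hLK (Submodule.starProjection_apply_mem L v₀))⟩
      have h1 := h' a₀ _ hm
      rwa [map_sub, h a₀ _ (Submodule.starProjection_apply_mem L v₀), sub_zero] at h1
    rw [Submodule.eq_bot_iff]
    intro x hx
    have : x ∈ Lᗮ ⊓ K := hLP.ge (hLK hx)
    exact inner_self_eq_zero.1 (this.1 x hx)
  obtain ⟨H', i1, i2, i3, π', hπ', hfin, -⟩ :=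
    exists_isIrreducibleRep_of_finiteDimensional (restrictRep π K hK) (fun h => hne (by
      rw [← restrictRep_apply π K hK a₀ ⟨v₀, hv₀⟩, h]; rfl)) (fun L' hL' => by
      rcases hirr (L'.map K.subtype) (Submodule.map_subtype_le _ _) (fun a v hv => by
        obtain ⟨w, hw, rfl⟩ := hv
        exact ⟨_, hL' a w hw, restrictRep_apply π K hK a w⟩) with h | h
      · left
        refine Submodule.map_injective_of_injective K.subtype_injective ?_
        rw [h, Submodule.map_bot]
      · right
        refine Submodule.map_injective_of_injective K.subtype_injective ?_
        rw [h, Submodule.map_subtype_top])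
  have hKn := hA H' π' hπ'
  have hKtop : K = ⊤ := Submodule.eq_top_of_finrank_eq (by rw [← hfin, hKn, hH])
  rw [hKtop] at hirr
  exact hirr L le_top hL

/-- A subspace of the full matrix algebra that is a nonzero two-sided ideal is everything. -/
theorem eq_top_of_ideal {n : ℕ} (J : Submodule ℂ (M n)) (hl : ∀ x, ∀ y ∈ J, x * y ∈ J)
    (hr : ∀ x, ∀ y ∈ J, y * x ∈ J) {y : M n} (hy : y ∈ J) (h0 : y ≠ 0) : J = ⊤ := by
  obtain ⟨p, q, hpq⟩ : ∃ p q, y p q ≠ 0 := by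
    by_contra! h
    exact h0 (Matrix.ext h)
  rw [Submodule.eq_top_iff']
  intro x
  rw [Matrix.matrix_eq_sum_single x]
  refine J.sum_mem fun i _ => J.sum_mem fun j _ => ?_
  have h1 := J.smul_mem (x i j * (y p q)⁻¹)
    (hr (Matrix.single q j 1) _ (hl (Matrix.single i p 1) y hy))
  have h2 : (x i j * (y p q)⁻¹) • (Matrix.single i p 1 * y * Matrix.single q j 1) =
      Matrix.single i j (x i j) := by
    rw [Matrix.single_mul_mul_single]
    simp [hpq]
  rwa [h2] at h1

/-- Every nonzero `*`-homomorphism from an `n`-homogeneous C*-algebra to `Mₙ` is surjective. -/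
theorem surjective_of_isHomogeneous {n : ℕ} (hn : 1 ≤ n) (hA : IsHomogeneous A n)
    (φ : A →⋆ₙₐ[ℂ] M n) (h0 : φ ≠ 0) : Function.Surjective φ := by
  have : Nonempty (Fin n) := ⟨⟨0, hn⟩⟩
  let e : M n ≃⋆ₐ[ℂ] _ := Matrix.toEuclideanCLM (𝕜 := ℂ) (n := Fin n)
  let π : A →⋆ₙₐ[ℂ] (EuclideanSpace ℂ (Fin n) →L[ℂ] EuclideanSpace ℂ (Fin n)) :=
    e.toNonUnitalStarAlgHom.comp φ
  have hπ : ∀ a, π a = e (φ a) := fun a => rfl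
  have hπ0 : π ≠ 0 := by
    intro h
    refine h0 ?_
    ext1 a
    have : e (φ a) = 0 := by rw [← hπ, h]; rfl
    exact (map_eq_zero_iff e e.injective).1 this
  have hirr := eq_bot_or_eq_top_of_isHomogeneous hA (by simp) π hπ0
  -- Burnside's theorem needs a unit, so it is applied to the unitization. The range of `φ` is then
  -- a nonzero ideal in the full matrix algebra, which is simple.
  let φ' : Unitization ℂ A →ₐ[ℂ] M n := Unitization.lift (φ : A →ₙₐ[ℂ] M n)
  have hφ' : ∀ (c : ℂ) (a : A), φ' (Unitization.inl c + (a : Unitization ℂ A)) = algebraMap ℂ _ c + φ a := fun c a => by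
    simp [φ']
    rfl
  let f : Unitization ℂ A →ₐ[ℂ] Module.End ℂ (EuclideanSpace ℂ (Fin n)) :=
    (Matrix.toLinAlgEquiv (EuclideanSpace.basisFun (Fin n) ℂ).toBasis :
      M n →ₐ[ℂ] _).comp φ'
  have hfφ : ∀ (a : A) v, f (a : Unitization ℂ A) v = π a v := by
    intro a v
    have : φ' (a : Unitization ℂ A) = φ a := by
      simp [φ']
      rfl
    change Matrix.toLinAlgEquiv (EuclideanSpace.basisFun (Fin n) ℂ).toBasis (φ' a) v = e (φ a) v
    rw [this]
    rfl
  have hf : Function.Surjective f := surjective_of_irreducible f fun K hK =>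
    hirr K fun a v hv => by
      rw [← hfφ]
      exact hK _ v hv
  have hφs : Function.Surjective φ' := by
    intro x
    obtain ⟨y, hy⟩ := hf (Matrix.toLinAlgEquiv (EuclideanSpace.basisFun (Fin n) ℂ).toBasis x)
    exact ⟨y, (Matrix.toLinAlgEquiv (EuclideanSpace.basisFun (Fin n) ℂ).toBasis).injective hy⟩
  obtain ⟨a₀, ha₀⟩ : ∃ a, φ a ≠ 0 := by
    by_contra! h
    exact h0 (by ext1 a; exact h a)
  have htop := eq_top_of_ideal (LinearMap.range (φ : A →ₗ[ℂ] M n)) (fun x y hy => by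
      obtain ⟨b, rfl⟩ := hy
      obtain ⟨z, rfl⟩ := hφs x
      induction z using Unitization.ind with
      | inl_add_inr c a =>
        refine ⟨c • b + a * b, ?_⟩
        rw [hφ']
        simp [add_mul, Algebra.algebraMap_eq_smul_one])
    (fun x y hy => by
      obtain ⟨b, rfl⟩ := hy
      obtain ⟨z, rfl⟩ := hφs x
      induction z using Unitization.ind with
      | inl_add_inr c a =>
        refine ⟨c • b + b * a, ?_⟩
        rw [hφ']
        simp [mul_add, Algebra.algebraMap_eq_smul_one]) ⟨a₀, rfl⟩ ha₀
  intro x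
  obtain ⟨a, ha⟩ := htop.ge (Submodule.mem_top (x := x))
  exact ⟨a, ha⟩

/-- The kernel of a nonzero `*`-homomorphism to `Mₙ` is primitive. -/
theorem isPrimitiveIdeal_ker {n : ℕ} (hA : IsHomogeneous A n) (φ : A →⋆ₙₐ[ℂ] M n)
    (h0 : φ ≠ 0) : IsPrimitiveIdeal (TwoSidedIdeal.ker φ) := by
  let e : M n ≃⋆ₐ[ℂ] _ := Matrix.toEuclideanCLM (𝕜 := ℂ) (n := Fin n)
  let π : A →⋆ₙₐ[ℂ] (EuclideanSpace ℂ (Fin n) →L[ℂ] EuclideanSpace ℂ (Fin n)) :=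
    e.toNonUnitalStarAlgHom.comp φ
  have hπ : ∀ a, π a = 0 ↔ φ a = 0 := fun a => map_eq_zero_iff e e.injective
  have hπ0 : π ≠ 0 := fun h => h0 (by ext1 a; exact (hπ a).1 (by rw [h]; rfl))
  obtain ⟨H', i1, i2, i3, π', hπ', -, hz⟩ := exists_isIrreducibleRep_of_finiteDimensional π hπ0
    (eq_bot_or_eq_top_of_isHomogeneous hA (by simp) π hπ0)
  refine ⟨H', i1, i2, i3, π', hπ', ?_⟩
  ext a
  rw [TwoSidedIdeal.mem_ker, TwoSidedIdeal.mem_ker, hz, hπ]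

/-- A primitive ideal is the kernel of a nonzero `*`-homomorphism to `Mₙ`. -/
theorem exists_hom_of_isPrimitiveIdeal {n : ℕ} (hn : 1 ≤ n) (hA : IsHomogeneous A n)
    {I : TwoSidedIdeal A} (hI : IsPrimitiveIdeal I) :
    ∃ φ : A →⋆ₙₐ[ℂ] M n, φ ≠ 0 ∧ TwoSidedIdeal.ker φ = I := by
  obtain ⟨H, i1, i2, i3, π, hπ, rfl⟩ := hI
  have hH := hA H π hπ
  have : FiniteDimensional ℂ H := FiniteDimensional.of_finrank_pos (by omega)
  let b : OrthonormalBasis (Fin n) ℂ H := (stdOrthonormalBasis ℂ H).reindex (finCongr hH)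
  let c : (H →L[ℂ] H) ≃⋆ₐ[ℂ] M n := b.repr.conjStarAlgEquiv.trans Matrix.toEuclideanCLM.symm
  let φ : A →⋆ₙₐ[ℂ] M n := c.toNonUnitalStarAlgHom.comp π
  have hz : ∀ a, φ a = 0 ↔ π a = 0 := fun a => map_eq_zero_iff c c.injective
  refine ⟨φ, fun h => hπ.ne_zero ?_, ?_⟩
  · ext1 a; exact (hz a).1 (by rw [h]; rfl)
  · ext a
    rw [TwoSidedIdeal.mem_ker, TwoSidedIdeal.mem_ker, hz]

end FiniteDimensional

/-! ### The space of irreducible representations on `ℂⁿ` and its map to the spectrum -/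

section Reps

open scoped Matrix.Norms.L2Operator

/-- The function vanishing exactly on `[-c, c]` detects whether the norm exceeds `c`. -/
theorem cfcₙ_excess_eq_zero_iff {D : Type*} [NonUnitalCStarAlgebra D] {d : D}
    (hd : IsSelfAdjoint d) {c : ℝ} (hc : 0 ≤ c) :
    cfcₙ (fun r : ℝ => max (|r| - c) 0) d = 0 ↔ ‖d‖ ≤ c := by
  have hcont : ContinuousOn (fun r : ℝ => max (|r| - c) 0) (quasispectrum ℝ d) := by fun_prop
  have h0 : max (|(0 : ℝ)| - c) 0 = 0 := by simpa using hc
  constructor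
  · intro h
    conv_lhs => rw [← cfcₙ_id ℝ d]
    refine norm_cfcₙ_le fun r hr => ?_
    have := norm_apply_le_norm_cfcₙ (fun r : ℝ => max (|r| - c) 0) d hr hcont h0 hd
    rw [h, norm_zero, Real.norm_eq_abs, abs_of_nonneg (le_max_right _ _)] at this
    have := (le_max_left _ _).trans this
    simpa using this
  · intro h
    have : Set.EqOn (fun r : ℝ => max (|r| - c) 0) (fun _ => 0) (quasispectrum ℝ d) := by
      intro r hr
      have h1 : ‖r‖ ≤ ‖d‖ := by
        have := norm_apply_le_norm_cfcₙ (id : ℝ → ℝ) d hr continuousOn_id rfl hd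
        rwa [cfcₙ_id ℝ d] at this
      rw [Real.norm_eq_abs] at h1
      exact max_eq_right (by linarith)
    rw [cfcₙ_congr this]
    exact cfcₙ_const_zero ℝ d

theorem map_cfcₙ_real {D D' : Type*} [NonUnitalCStarAlgebra D] [NonUnitalCStarAlgebra D']
    (φ : D →⋆ₙₐ[ℂ] D') {f : ℝ → ℝ} (hf : Continuous f) (h0 : f 0 = 0) {d : D}
    (hd : IsSelfAdjoint d) : φ (cfcₙ f d) = cfcₙ f (φ d) :=
  NonUnitalStarAlgHom.map_cfcₙ φ f d hf.continuousOn h0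
    (AddMonoidHomClass.continuous_of_bound φ 1 fun x => by
      simpa using NonUnitalStarAlgHom.norm_apply_le φ x) hd (hd.map φ)

variable {A : Type u} [NonUnitalCStarAlgebra A] {T : Type v} [TopologicalSpace T]

/-- Two surjections onto `Mₙ` with the same kernel differ by an automorphism of `Mₙ`. -/
theorem exists_starAlgEquiv_of_ker_eq {n : ℕ} (φ ψ : A →⋆ₙₐ[ℂ] M n) (hφ : Function.Surjective φ)
    (hψ : Function.Surjective ψ) (hker : ∀ a, φ a = 0 ↔ ψ a = 0) :
    ∃ g : M n ≃⋆ₐ[ℂ] M n, ∀ a, g (φ a) = ψ a := by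
  have key : ∀ a b, φ a = φ b ↔ ψ a = ψ b := fun a b => by
    rw [← sub_eq_zero, ← map_sub, hker, map_sub, sub_eq_zero]
  let s := Function.surjInv hφ
  have hs : ∀ m, φ (s m) = m := Function.surjInv_eq hφ
  have hψs : ∀ m a, φ a = m → ψ (s m) = ψ a := fun m a h => (key _ _).1 ((hs m).trans h.symm)
  let g : M n →⋆ₙₐ[ℂ] M n :=
    { toFun := fun m => ψ (s m)
      map_smul' := fun c m => by
        rw [hψs _ (c • s m) (by rw [map_smul, hs]), map_smul]; rfl
      map_zero' := by rw [hψs _ 0 (map_zero φ), map_zero]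
      map_add' := fun x y => by rw [hψs _ (s x + s y) (by rw [map_add, hs, hs]), map_add]
      map_mul' := fun x y => by rw [hψs _ (s x * s y) (by rw [map_mul, hs, hs]), map_mul]
      map_star' := fun x => by rw [hψs _ (star (s x)) (by rw [map_star, hs]), map_star] }
  have hg : ∀ a, g (φ a) = ψ a := fun a => hψs _ a rfl
  refine ⟨StarAlgEquiv.ofBijective g ⟨fun x y hxy => ?_, fun y => ?_⟩, hg⟩
  · rw [← hs x, ← hs y]
    exact (key _ _).2 hxy
  · obtain ⟨a, rfl⟩ := hψ y
    exact ⟨φ a, hg a⟩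

/-- A representation on `ℂⁿ` with kernel a given point of the spectrum. -/
@[ext]
structure Rep (θ : T ≃ₜ PrimitiveSpectrum A) (n : ℕ) where
  base : T
  hom : A →⋆ₙₐ[ℂ] M n
  ker_hom : TwoSidedIdeal.ker hom = (θ base).1

variable {θ : T ≃ₜ PrimitiveSpectrum A} {n : ℕ}

/-- The base is left out because it depends continuously on the homomorphism
(`Rep.continuous_base`). Compactness thus concerns the homomorphisms alone. -/
instance : TopologicalSpace (Rep θ n) :=
  TopologicalSpace.induced (fun x (a : A) => x.hom a) inferInstance

theorem exists_eq_of_isPrimitiveIdeal (θ : T ≃ₜ PrimitiveSpectrum A) {I : TwoSidedIdeal A}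
    (hI : IsPrimitiveIdeal I) : ∃ t, (θ t).1 = I := by
  obtain ⟨t, ht⟩ := θ.surjective (⟨I, hI⟩ : {I : TwoSidedIdeal A // IsPrimitiveIdeal I})
  exact ⟨t, congrArg Subtype.val ht⟩

namespace Rep

theorem hom_eq_zero_iff (x : Rep θ n) (a : A) : x.hom a = 0 ↔ a ∈ (θ x.base).1 := by
  rw [← x.ker_hom, TwoSidedIdeal.mem_ker]

theorem hom_ne_zero (x : Rep θ n) : x.hom ≠ 0 := by
  intro h
  obtain ⟨H, i1, i2, i3, π, hπ, hI⟩ := (θ x.base).2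
  refine hπ.ne_zero ?_
  ext1 a
  have : a ∈ (θ x.base).1 := (x.hom_eq_zero_iff a).1 (by rw [h]; rfl)
  rw [hI, TwoSidedIdeal.mem_ker] at this
  exact this

theorem surjective (hn : 1 ≤ n) (hA : IsHomogeneous A n) (x : Rep θ n) :
    Function.Surjective x.hom := surjective_of_isHomogeneous hn hA _ x.hom_ne_zero

theorem continuous_hom_apply (a : A) : Continuous fun x : Rep θ n => x.hom a :=
  (continuous_apply a).comp continuous_induced_dom

/-- The preimage of a subbasic open set `{P | a ∉ P}` is the open condition `x.hom a ≠ 0`. -/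
theorem continuous_base : Continuous (base : Rep θ n → T) := by
  have : Continuous fun x : Rep θ n => θ x.base := by
    rw [continuous_generateFrom_iff]
    rintro _ ⟨a, rfl⟩
    have : (fun x : Rep θ n => θ x.base) ⁻¹' {P : PrimitiveSpectrum A | a ∉ P.1} =
        {x | x.hom a ≠ 0} := by
      ext x
      exact (not_congr (x.hom_eq_zero_iff a)).symm
    rw [this]
    exact isOpen_ne_fun (continuous_hom_apply a) continuous_const
  simpa [Function.comp_def] using θ.symm.continuous.comp this

theorem exists_base_eq (hn : 1 ≤ n) (hA : IsHomogeneous A n) (t : T) :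
    ∃ x : Rep θ n, x.base = t := by
  obtain ⟨φ, -, hφ⟩ := exists_hom_of_isPrimitiveIdeal hn hA (θ t).2
  exact ⟨⟨t, φ, hφ⟩, rfl⟩

theorem exists_hom_eq (hA : IsHomogeneous A n) (φ : A →⋆ₙₐ[ℂ] M n) (h0 : φ ≠ 0) :
    ∃ x : Rep θ n, x.hom = φ := by
  obtain ⟨t, ht⟩ := exists_eq_of_isPrimitiveIdeal θ (isPrimitiveIdeal_ker hA φ h0)
  exact ⟨⟨t, φ, ht.symm⟩, rfl⟩

theorem exists_equiv (hn : 1 ≤ n) (hA : IsHomogeneous A n) {x y : Rep θ n}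
    (h : x.base = y.base) : ∃ g : M n ≃⋆ₐ[ℂ] M n, ∀ a, g (x.hom a) = y.hom a :=
  exists_starAlgEquiv_of_ker_eq _ _ (x.surjective hn hA) (y.surjective hn hA) fun a => by
    rw [hom_eq_zero_iff, hom_eq_zero_iff, h]

theorem norm_eq (hn : 1 ≤ n) (hA : IsHomogeneous A n) {x y : Rep θ n} (h : x.base = y.base)
    (a : A) : ‖x.hom a‖ = ‖y.hom a‖ := by
  obtain ⟨g, hg⟩ := exists_equiv hn hA h
  rw [← hg, StarAlgEquiv.norm_map]

/-- Homomorphisms are contractive, and the algebraic identities are closed conditions in a product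
of balls of `Mₙ`. The zero homomorphism belongs to this set, so compactness of sets of
representations needs a lower norm bound. -/
theorem isCompact_hom_range (A : Type u) [NonUnitalCStarAlgebra A] (n : ℕ) :
    IsCompact (Set.range fun (φ : A →⋆ₙₐ[ℂ] M n) (a : A) => φ a) := by
  have hK : IsCompact (Set.univ.pi fun a : A => Metric.closedBall (0 : M n) ‖a‖) :=
    isCompact_univ_pi fun x => isCompact_closedBall _ _
  have hr : (Set.range fun (φ : A →⋆ₙₐ[ℂ] M n) (a : A) => φ a) =
      {f | (∀ (c : ℂ) x, f (c • x) = c • f x) ∧ (∀ x y, f (x + y) = f x + f y) ∧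
        (∀ x y, f (x * y) = f x * f y) ∧ (∀ x, f (star x) = star (f x))} := by
    ext f
    constructor
    · rintro ⟨φ, rfl⟩
      exact ⟨fun c x => map_smul φ c x, fun x y => map_add φ x y, fun x y => map_mul φ x y,
        fun x => map_star φ x⟩
    · rintro ⟨h1, h2, h3, h4⟩
      exact ⟨{ toFun := f, map_smul' := h1, map_add' := h2, map_mul' := h3, map_star' := h4,
               map_zero' := by simpa using h1 0 0 }, rfl⟩
  refine hK.of_isClosed_subset ?_ ?_
  · rw [hr]
    simp only [Set.ofPred_and, Set.ofPred_forall]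
    refine IsClosed.inter ?_ (IsClosed.inter ?_ (IsClosed.inter ?_ ?_))
    · exact isClosed_iInter fun x => isClosed_iInter fun y => isClosed_eq (by fun_prop) (by fun_prop)
    · exact isClosed_iInter fun x => isClosed_iInter fun y => isClosed_eq (by fun_prop) (by fun_prop)
    · exact isClosed_iInter fun x => isClosed_iInter fun y => isClosed_eq (by fun_prop) (by fun_prop)
    · exact isClosed_iInter fun x => isClosed_eq (by fun_prop) (by fun_prop)
  · rintro _ ⟨φ, rfl⟩ a _
    simpa using NonUnitalStarAlgHom.norm_apply_le φ a

/-- Closed sets of representations on which some element is bounded below are compact. -/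
theorem isCompact_of_isClosed (hA : IsHomogeneous A n) (a : A) {ε : ℝ} (hε : 0 < ε)
    {P : (A → M n) → Prop} (hP : IsClosed {f | P f}) (hPa : ∀ f, P f → ε ≤ ‖f a‖) :
    IsCompact {x : Rep θ n | P fun b => x.hom b} := by
  have hind : IsInducing fun (x : Rep θ n) (a : A) => x.hom a := ⟨rfl⟩
  rw [hind.isCompact_iff]
  have : (fun (x : Rep θ n) (a : A) => x.hom a) '' {x : Rep θ n | P fun b => x.hom b} =
      (Set.range fun (φ : A →⋆ₙₐ[ℂ] M n) (a : A) => φ a) ∩ {f | P f} := by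
    ext f
    constructor
    · rintro ⟨x, hx, rfl⟩
      exact ⟨⟨x.hom, rfl⟩, hx⟩
    · rintro ⟨⟨φ, rfl⟩, hφ⟩
      have hφ0 : φ ≠ 0 := by
        rintro rfl
        have := hPa _ hφ
        simp at this
        linarith
      obtain ⟨x, rfl⟩ := exists_hom_eq (θ := θ) hA φ hφ0
      exact ⟨x, hφ, rfl⟩
  rw [this]
  exact (isCompact_hom_range A n).inter_right hP

theorem isCompact_le_norm (hA : IsHomogeneous A n) (a : A) {ε : ℝ} (hε : 0 < ε) :
    IsCompact {x : Rep θ n | ε ≤ ‖x.hom a‖} :=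
  isCompact_of_isClosed (P := fun f => ε ≤ ‖f a‖) hA a hε
    (isClosed_le continuous_const (continuous_apply a).norm) fun _ h => h

theorem isOpen_notMem (θ : T ≃ₜ PrimitiveSpectrum A) (a : A) : IsOpen {t | a ∉ (θ t).1} :=
  (TopologicalSpace.isOpen_generateFrom_of_mem ⟨a, rfl⟩ :
    IsOpen {P : PrimitiveSpectrum A | a ∉ P.1}).preimage θ.continuous

/-- Lower semicontinuity of the norm. -/
theorem exists_isOpen_lt_norm (x : Rep θ n) (a : A) {c : ℝ} (hc : 0 ≤ c) (hx : c < ‖x.hom a‖) :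
    ∃ U, IsOpen U ∧ x.base ∈ U ∧ ∀ y : Rep θ n, y.base ∈ U → c < ‖y.hom a‖ := by
  let f : ℝ → ℝ := fun r => max (|r| - c * c) 0
  have hf : Continuous f := by fun_prop
  have hcc : 0 ≤ c * c := mul_nonneg hc hc
  have h0 : f 0 = 0 := by simpa [f] using hcc
  -- Cutting `a*a` off at `c²` turns `c < ‖y.hom a‖` into nonmembership in the kernel, which is open
  -- by definition of the hull-kernel topology.
  have key : ∀ y : Rep θ n, cfcₙ f (star a * a) ∉ (θ y.base).1 ↔ c < ‖y.hom a‖ := by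
    intro y
    rw [← hom_eq_zero_iff, map_cfcₙ_real _ hf h0 (.star_mul_self a),
      cfcₙ_excess_eq_zero_iff ((IsSelfAdjoint.star_mul_self a).map y.hom) hcc, map_mul, map_star,
      CStarRing.norm_star_mul_self, not_le]
    exact ⟨fun h => lt_of_mul_self_lt_mul_self₀ (norm_nonneg _) h,
      fun h => mul_self_lt_mul_self hc h⟩
  exact ⟨_, isOpen_notMem θ (cfcₙ f (star a * a)), (key x).2 hx, fun y hy => (key y).1 hy⟩

/-- The spectrum carries the quotient topology from the space of representations. -/
theorem isQuotientMap_base [T2Space T] (hn : 1 ≤ n) (hA : IsHomogeneous A n) :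
    IsQuotientMap (base : Rep θ n → T) := by
  rw [isQuotientMap_iff_isClosed]
  refine ⟨exists_base_eq hn hA, fun S => ⟨fun h => h.preimage continuous_base, fun h => ?_⟩⟩
  refine isClosed_of_closure_subset fun t ht => ?_
  obtain ⟨x, rfl⟩ := exists_base_eq (θ := θ) hn hA t
  have hpos : Nonempty (Fin n) := ⟨⟨0, hn⟩⟩
  obtain ⟨a, ha⟩ := x.surjective hn hA 1
  have hlt : (1 / 2 : ℝ) < ‖x.hom a‖ := by
    rw [ha, norm_one]; norm_num
  -- Near the point, all representations have `‖y.hom a‖ > 1/2`. The part of `S` there thus lies in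
  -- the image of a compact set, which is closed since `T` is Hausdorff.
  obtain ⟨U, hU, hxU, hUn⟩ := exists_isOpen_lt_norm x a (by norm_num) hlt
  have hcomp : IsClosed (base '' ({x : Rep θ n | 1 / 2 ≤ ‖x.hom a‖} ∩ base ⁻¹' S)) :=
    (((isCompact_le_norm hA a (by norm_num)).inter_right h).image continuous_base).isClosed
  have hsub : U ∩ S ⊆ base '' ({x : Rep θ n | 1 / 2 ≤ ‖x.hom a‖} ∩ base ⁻¹' S) := by
    rintro s ⟨hsU, hsS⟩
    obtain ⟨y, rfl⟩ := exists_base_eq (θ := θ) hn hA s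
    exact ⟨y, ⟨(hUn y hsU).le, hsS⟩, rfl⟩
  have : x.base ∈ closure (U ∩ S) := hU.inter_closure ⟨hxU, ht⟩
  obtain ⟨y, ⟨-, hyS⟩, hy⟩ := hcomp.closure_subset_iff.2 hsub this
  exact hy ▸ hyS

theorem eq_zero_of_forall_hom (hn : 1 ≤ n) (hA : IsHomogeneous A n) {a : A}
    (h : ∀ x : Rep θ n, x.hom a = 0) : a = 0 := by
  by_contra ha
  obtain ⟨H, i1, i2, i3, π, hπ, hne⟩ := exists_irreducibleRep_ne_zero ha
  obtain ⟨t, ht⟩ := exists_eq_of_isPrimitiveIdeal θ (I := TwoSidedIdeal.ker π)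
    ⟨H, i1, i2, i3, π, hπ, rfl⟩
  obtain ⟨x, hx⟩ := exists_base_eq (θ := θ) hn hA t
  have := (x.hom_eq_zero_iff a).1 (h x)
  rw [hx, ht] at this
  exact hne ((TwoSidedIdeal.mem_ker π).1 this)

theorem eq_of_forall_hom (hn : 1 ≤ n) (hA : IsHomogeneous A n) {a b : A}
    (h : ∀ x : Rep θ n, x.hom a = x.hom b) : a = b :=
  sub_eq_zero.1 (eq_zero_of_forall_hom (θ := θ) hn hA fun x => by rw [map_sub, h, sub_self])

/-- The part of `a*a` exceeding `c²` vanishes in every representation, hence vanishes. -/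
theorem norm_le_of_forall_hom (hn : 1 ≤ n) (hA : IsHomogeneous A n) {a : A} {c : ℝ} (hc : 0 ≤ c)
    (h : ∀ x : Rep θ n, ‖x.hom a‖ ≤ c) : ‖a‖ ≤ c := by
  have hcc : 0 ≤ c * c := mul_nonneg hc hc
  have : ‖star a * a‖ ≤ c * c := by
    rw [← cfcₙ_excess_eq_zero_iff (.star_mul_self a) hcc]
    refine eq_zero_of_forall_hom (θ := θ) hn hA fun x => ?_
    rw [map_cfcₙ_real _ (by fun_prop) (by simpa using hcc) (.star_mul_self a),
      cfcₙ_excess_eq_zero_iff ((IsSelfAdjoint.star_mul_self a).map x.hom) hcc, map_mul, map_star,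
      CStarRing.norm_star_mul_self]
    exact mul_self_le_mul_self (norm_nonneg _) (h x)
  rw [CStarRing.norm_star_mul_self] at this
  exact abs_le_of_sq_le_sq' (by nlinarith) hc |>.2

/-- A property of representations that is open and only depends on the kernel defines an open set
of the spectrum. -/
theorem isOpen_base_image [T2Space T] (hn : 1 ≤ n) (hA : IsHomogeneous A n)
    {Q : Rep θ n → Prop} (hQ : IsOpen {x | Q x}) (hinv : ∀ x y, x.base = y.base → Q x → Q y) :
    IsOpen {t | ∀ x : Rep θ n, x.base = t → Q x} := by
  rw [← (isQuotientMap_base hn hA).isOpen_preimage]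
  convert hQ using 1
  ext x
  exact ⟨fun h => h x rfl, fun h y hy => hinv x y hy.symm h⟩

/-- Upper semicontinuity of the fibre norm, read through the quotient map from `Rep θ n`. -/
theorem isOpen_norm_lt [T2Space T] (hn : 1 ≤ n) (hA : IsHomogeneous A n) (a : A) (c : ℝ) :
    IsOpen {t | ∀ x : Rep θ n, x.base = t → ‖x.hom a‖ < c} :=
  isOpen_base_image hn hA (isOpen_lt (continuous_hom_apply a).norm continuous_const)
    fun _ _ h hx => norm_eq hn hA h a ▸ hx

end Rep

end Reps

/-! ### Local matrix units -/

section MatrixUnits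

open scoped Matrix.Norms.L2Operator

theorem cfcₙ_algebraMap_real {D : Type*} [CStarAlgebra D] {f : ℝ → ℝ} (hf : Continuous f)
    (h0 : f 0 = 0) (r : ℝ) : cfcₙ f (algebraMap ℝ D r) = algebraMap ℝ D (f r) := by
  rw [cfcₙ_eq_cfc hf.continuousOn h0, cfc_algebraMap]

/-- Functional calculus commutes with homomorphisms and acts coordinatewise on `ℂᵏ`. This computes
it for every element diagonalized by some `ψ`. -/
theorem cfcₙ_hom_pi {k : ℕ} {D : Type*} [NonUnitalCStarAlgebra D] (ψ : (Fin k → ℂ) →⋆ₙₐ[ℂ] D)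
    {f : ℝ → ℝ} (hf : Continuous f) (h0 : f 0 = 0) (d : Fin k → ℝ) :
    cfcₙ f (ψ fun i => (d i : ℂ)) = ψ fun i => (f (d i) : ℂ) := by
  have hsa : IsSelfAdjoint (fun i => (d i : ℂ) : Fin k → ℂ) := by
    rw [IsSelfAdjoint]
    ext i
    simp
  rw [← map_cfcₙ_real ψ hf h0 hsa, cfcₙ_map_pi (S := ℂ) f _ hf.continuousOn hsa (fun i => by
      rw [IsSelfAdjoint]; simp)]
  congr 1
  funext i
  exact cfcₙ_algebraMap_real hf h0 (d i)

/-- The embedding of `ℂⁿ` as the diagonal matrices. -/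
def diagonalHom (n : ℕ) : (Fin n → ℂ) →⋆ₙₐ[ℂ] M n where
  toFun := Matrix.diagonal
  map_smul' c x := Matrix.diagonal_smul c x
  map_zero' := Matrix.diagonal_zero
  map_add' x y := (Matrix.diagonal_add x y).symm
  map_mul' x y := (Matrix.diagonal_mul_diagonal' x y).symm
  map_star' x := (Matrix.diagonal_conjTranspose x).symm

theorem cfcₙ_diagonal {n : ℕ} {f : ℝ → ℝ} (hf : Continuous f) (h0 : f 0 = 0) (d : Fin n → ℝ) :
    cfcₙ f (Matrix.diagonal fun i => (d i : ℂ) : M n) = Matrix.diagonal fun i => (f (d i) : ℂ) :=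
  cfcₙ_hom_pi (diagonalHom n) hf h0 d

/-- A full system of matrix units in `Mₙ` is the image of the standard one under an
automorphism. -/
theorem exists_starAlgEquiv_single {n : ℕ} (f : Fin n → Fin n → M n)
    (hmul : ∀ i j k l, f i j * f k l = if j = k then f i l else 0)
    (hstar : ∀ i j, star (f i j) = f j i) (h0 : ∀ i, f i i ≠ 0) :
    ∃ g : M n ≃⋆ₐ[ℂ] M n, ∀ i j, g (Matrix.single i j 1) = f i j := by
  let G : M n →⋆ₙₐ[ℂ] M n :=
    { toFun := fun m => ∑ i, ∑ j, m i j • f i j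
      map_smul' := fun c m => by simp [Finset.smul_sum, mul_smul]
      map_zero' := by simp
      map_add' := fun x y => by simp [add_smul, Finset.sum_add_distrib]
      map_mul' := fun x y => by
        simp only [Finset.sum_mul]
        simp only [Finset.mul_sum, smul_mul_smul_comm, hmul, Matrix.mul_apply, Finset.sum_smul]
        refine Finset.sum_congr rfl fun i _ => ?_
        rw [Finset.sum_comm]
        refine Finset.sum_congr rfl fun j _ => ?_
        rw [Finset.sum_comm]
        simp
      map_star' := fun x => by
        simp only [star_sum, star_smul, hstar]
        rw [Finset.sum_comm]
        rfl }
  have hG : ∀ i j, G (Matrix.single i j 1) = f i j := by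
    intro i j
    change ∑ k, ∑ l, (Matrix.single i j (1 : ℂ)) k l • f k l = _
    rw [Finset.sum_eq_single i, Finset.sum_eq_single j]
    · simp
    · intro l _ hl; simp [hl.symm]
    · simp
    · intro k _ hk; exact Finset.sum_eq_zero fun l _ => by simp [hk.symm]
    · simp
  have hinj : Function.Injective G := by
    rw [injective_iff_map_eq_zero]
    intro m hm
    ext p q
    by_contra hne
    -- Multiplying by matrix units isolates one entry of a matrix in the kernel.
    have h1 : G (Matrix.single p p 1 * m * Matrix.single q p 1) = 0 := by
      rw [map_mul, map_mul, hm, mul_zero, zero_mul]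
    rw [Matrix.single_mul_mul_single, mul_one, one_mul] at h1
    have h2 : Matrix.single p p (m p q) = m p q • (Matrix.single p p 1 : M n) := by simp
    rw [h2, map_smul, hG] at h1
    rcases smul_eq_zero.1 h1 with h | h
    · exact hne h
    · exact h0 p h
  have hsurj : Function.Surjective G :=
    (LinearMap.injective_iff_surjective (f := (G : M n →ₗ[ℂ] M n))).1 hinj
  exact ⟨StarAlgEquiv.ofBijective G ⟨hinj, hsurj⟩, hG⟩

/-- A bump function at `j + 1`. -/
def bump (j : ℕ) (r : ℝ) : ℝ := max 0 (min 1 (2 - 4 * |r - (j + 1)|))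

theorem continuous_bump (j : ℕ) : Continuous (bump j) := by unfold bump; fun_prop

theorem bump_eq_zero {j : ℕ} {r : ℝ} (h : 1 / 2 ≤ |r - (j + 1)|) : bump j r = 0 :=
  max_eq_left ((min_le_right _ _).trans (by linarith))

theorem bump_eq_one {j : ℕ} {r : ℝ} (h : |r - (j + 1)| ≤ 1 / 4) : bump j r = 1 := by
  rw [bump, min_eq_left (by linarith), max_eq_right zero_le_one]

/-- Centring the bumps at `j + 1` instead of `j` makes them vanish at `0`, as the non-unital
functional calculus requires. This is why diagonal test elements have entries `1, 2, …`. -/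
theorem bump_zero (j : ℕ) : bump j 0 = 0 := by
  apply bump_eq_zero
  rw [zero_sub, abs_neg, abs_of_nonneg (by positivity)]
  linarith [Nat.cast_nonneg (α := ℝ) j]

theorem bump_natCast (j k : ℕ) : bump j (k + 1 : ℝ) = if k = j then 1 else 0 := by
  split_ifs with h
  · subst h; exact bump_eq_one (by simp)
  · apply bump_eq_zero
    have h1 : (1 : ℝ) ≤ |(k : ℝ) - j| := by
      have h2 : (1 : ℤ) ≤ |(k : ℤ) - j| := Int.one_le_abs (by omega)
      exact_mod_cast h2
    have : (k + 1 - (j + 1) : ℝ) = k - j := by ring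
    rw [this]; linarith

theorem bump_mul_bump {i j : ℕ} (h : i ≠ j) (r : ℝ) : bump i r * bump j r = 0 := by
  by_cases h1 : 1 / 2 ≤ |r - (i + 1)|
  · rw [bump_eq_zero h1, zero_mul]
  · have h2 : (1 : ℝ) ≤ |(i : ℝ) - j| := by
      have h2 : (1 : ℤ) ≤ |(i : ℤ) - j| := Int.one_le_abs (by omega)
      exact_mod_cast h2
    have h3 : |(i : ℝ) - j| ≤ |r - (j + 1)| + |r - (i + 1)| := by
      have : (i : ℝ) - j = (r - (j + 1)) - (r - (i + 1)) := by ring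
      rw [this]; exact abs_sub _ _
    rw [bump_eq_zero (j := j) (by linarith), mul_zero]

/-- The distance to the integers. -/
def distInt (r : ℝ) : ℝ := Metric.infDist r (Set.range ((↑) : ℤ → ℝ))

theorem continuous_distInt : Continuous distInt := Metric.continuous_infDist_pt _

theorem distInt_intCast (k : ℤ) : distInt k = 0 := Metric.infDist_zero_of_mem ⟨k, rfl⟩

/-- Within `1/4` of an integer `k`, the bump is `1` when `k = j + 1`; otherwise `r` is at distance
over `3/4` from `j + 1` and the bump is `0`. -/
theorem bump_mul_self {r : ℝ} (h : distInt r < 1 / 4) (j : ℕ) : bump j r * bump j r = bump j r := by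
  obtain ⟨_, ⟨k, rfl⟩, hk⟩ := (Metric.infDist_lt_iff (Set.range_nonempty _)).1 h
  rw [Real.dist_eq] at hk
  by_cases hkj : k = j + 1
  · have : bump j r = 1 := by
      apply bump_eq_one
      have : (k : ℝ) = j + 1 := by exact_mod_cast hkj
      rw [← this]; exact hk.le
    rw [this, mul_one]
  · have h2 : (1 : ℝ) ≤ |(k : ℝ) - (j + 1)| := by
      have h2 : (1 : ℤ) ≤ |k - (j + 1)| := Int.one_le_abs (sub_ne_zero.2 hkj)
      exact_mod_cast h2
    have h3 : |(k : ℝ) - (j + 1)| ≤ |r - (j + 1)| + |r - k| := by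
      have : (k : ℝ) - (j + 1) = (r - (j + 1)) - (r - k) := by ring
      rw [this]; exact abs_sub _ _
    have : bump j r = 0 := bump_eq_zero (by linarith)
    rw [this, mul_zero]

/-- The norm bound keeps the spectrum within `1/4` of the integers, where the bump is idempotent.
Being a norm condition, it persists in nearby fibres. -/
theorem cfcₙ_bump_idem {D : Type*} [NonUnitalCStarAlgebra D] {d : D} (hd : IsSelfAdjoint d)
    (h : ‖cfcₙ distInt d‖ < 1 / 4) (j : ℕ) :
    cfcₙ (bump j) d * cfcₙ (bump j) d = cfcₙ (bump j) d := by
  rw [← cfcₙ_mul (bump j) (bump j) d (continuous_bump j).continuousOn (bump_zero j)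
    (continuous_bump j).continuousOn (bump_zero j)]
  refine cfcₙ_congr fun r hr => bump_mul_self (lt_of_le_of_lt ?_ h) j
  exact (le_abs_self _).trans (norm_apply_le_norm_cfcₙ distInt d hr
    continuous_distInt.continuousOn (by simpa using distInt_intCast 0) hd)

theorem cfcₙ_bump_mul {D : Type*} [NonUnitalCStarAlgebra D] (d : D) {i j : ℕ} (h : i ≠ j) :
    cfcₙ (bump i) d * cfcₙ (bump j) d = 0 := by
  rw [← cfcₙ_mul (bump i) (bump j) d (continuous_bump i).continuousOn (bump_zero i)
    (continuous_bump j).continuousOn (bump_zero j)]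
  simp only [bump_mul_bump h]
  exact cfcₙ_const_zero ℝ d

theorem cfcₙ_bump_hom_pi {k : ℕ} {D : Type*} [NonUnitalCStarAlgebra D]
    (ψ : (Fin k → ℂ) →⋆ₙₐ[ℂ] D) (j : ℕ) :
    cfcₙ (bump j) (ψ fun i => ((i : ℕ) : ℂ) + 1) = ψ fun i => if (i : ℕ) = j then 1 else 0 := by
  have := cfcₙ_hom_pi ψ (continuous_bump j) (bump_zero j) (fun i : Fin k => ((i : ℕ) + 1 : ℝ))
  simp only [bump_natCast] at this
  push_cast at this
  rw [this]
  congr 1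
  ext i
  split_ifs <;> simp

theorem distInt_zero : distInt 0 = 0 := by simpa using distInt_intCast 0

theorem cfcₙ_distInt_hom_pi {k : ℕ} {D : Type*} [NonUnitalCStarAlgebra D]
    (ψ : (Fin k → ℂ) →⋆ₙₐ[ℂ] D) (d : Fin k → ℕ) :
    cfcₙ distInt (ψ fun i => (d i : ℂ)) = 0 := by
  have := cfcₙ_hom_pi ψ continuous_distInt distInt_zero (fun i : Fin k => (d i : ℝ))
  have h2 : ∀ i, distInt (d i : ℝ) = 0 := fun i => by simpa using distInt_intCast (d i)
  simp only [h2] at this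
  push_cast at this
  rw [this]
  exact map_zero ψ

variable {A : Type u} [NonUnitalCStarAlgebra A] {T : Type v} [TopologicalSpace T]
  {θ : T ≃ₜ PrimitiveSpectrum A} {n : ℕ}

/-- Spectral projections of an element with integral spectrum at a point stay projections
nearby. -/
theorem exists_isOpen_bump_idem [T2Space T] (hn : 1 ≤ n) (hA : IsHomogeneous A n) (x : Rep θ n)
    {h : A} (hh : IsSelfAdjoint h) (hx : cfcₙ distInt (x.hom h) = 0) :
    ∃ U, IsOpen U ∧ x.base ∈ U ∧ ∀ y : Rep θ n, y.base ∈ U → ∀ j,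
      y.hom (cfcₙ (bump j) h) * y.hom (cfcₙ (bump j) h) = y.hom (cfcₙ (bump j) h) := by
  refine ⟨_, Rep.isOpen_norm_lt (θ := θ) hn hA (cfcₙ distInt h) (1 / 4), fun y hy => ?_,
    fun y hy j => ?_⟩
  · rw [Rep.norm_eq hn hA hy, map_cfcₙ_real _ continuous_distInt distInt_zero hh, hx, norm_zero]
    norm_num
  · have := hy y rfl
    rw [map_cfcₙ_real _ continuous_distInt distInt_zero hh] at this
    rw [map_cfcₙ_real _ (continuous_bump j) (bump_zero j) hh]
    exact cfcₙ_bump_idem (hh.map y.hom) this j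

/-- `r ↦ bump 0 r / √r`. -/
def invSqrtBump (r : ℝ) : ℝ := bump 0 r * (√(max r (1 / 4)))⁻¹

theorem continuous_invSqrtBump : Continuous invSqrtBump := by
  refine (continuous_bump 0).mul (Continuous.inv₀ (by fun_prop) fun r => ?_)
  have : 0 < max r (1 / 4 : ℝ) := lt_max_of_lt_right (by norm_num)
  positivity

theorem invSqrtBump_zero : invSqrtBump 0 = 0 := by rw [invSqrtBump, bump_zero, zero_mul]

/-- The scalar form of polar decomposition: with `c = v*v` and `r = invSqrtBump c`, it makes `v r`
have `(v r)*(v r) = bump(c)²`. The cutoff `1/4` is harmless because the bump vanishes for `r ≤ 1/2`.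
-/
theorem invSqrtBump_mul (r : ℝ) : invSqrtBump r * r * invSqrtBump r = bump 0 r * bump 0 r := by
  by_cases h : 1 / 2 ≤ |r - ((0 : ℕ) + 1)|
  · rw [invSqrtBump, bump_eq_zero h]; simp
  · have hr : 1 / 4 ≤ r := by
      push Not at h
      have := (abs_lt.1 h).1
      push_cast at this
      linarith
    have hs : √r * √r = r := Real.mul_self_sqrt (by linarith)
    have hne : √r ≠ 0 := (Real.sqrt_pos.2 (by linarith)).ne'
    rw [invSqrtBump, max_eq_left hr]
    field_simp
    rw [sq √r, hs]

/-- If `p` is a right unit for `d`, then also for the continuous functions of `d`. -/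
theorem cfcₙ_bump_mul_of_mul_eq {D : Type*} [NonUnitalCStarAlgebra D] {d p : D}
    (hd : IsSelfAdjoint d) (h : d * p = d) : cfcₙ (bump 0) d * p = cfcₙ (bump 0) d := by
  let β : ℝ → ℝ := fun r => bump 0 r * (max r (1 / 4))⁻¹
  have hβ : Continuous β := by
    refine (continuous_bump 0).mul (Continuous.inv₀ (by fun_prop) fun r => ?_)
    have : 0 < max r (1 / 4 : ℝ) := lt_max_of_lt_right (by norm_num)
    positivity
  have hβ0 : β 0 = 0 := by simp [β, bump_zero]
  have hb : bump 0 = fun r => β r * id r := by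
    funext r
    by_cases h : 1 / 2 ≤ |r - ((0 : ℕ) + 1)|
    · simp [β, bump_eq_zero h]
    · have hr : 1 / 4 ≤ r := by
        push Not at h
        have := (abs_lt.1 h).1
        push_cast at this
        linarith
      simp only [β, max_eq_left hr, id]
      field_simp
  rw [hb, cfcₙ_mul β id d hβ.continuousOn hβ0 continuousOn_id rfl, cfcₙ_id ℝ d, mul_assoc, h]

/-- Two comparable projections at distance less than `1` are equal. -/
theorem eq_of_norm_sub_lt_one {D : Type*} [NonUnitalCStarAlgebra D] {p q : D}
    (hp : IsSelfAdjoint p) (hq : IsSelfAdjoint q) (hpp : p * p = p) (hqq : q * q = q)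
    (hqp : q * p = q) (h : ‖p - q‖ < 1) : p = q := by
  have hpq : p * q = q := by
    have := congrArg star hqp
    rwa [star_mul, hp.star_eq, hq.star_eq] at this
  -- Since `q ≤ p`, the difference is a projection, whose norm is `0` or `1`.
  have hsq : star (p - q) * (p - q) = p - q := by
    rw [(hp.sub hq).star_eq, sub_mul, mul_sub, mul_sub, hpp, hqq, hqp, hpq]
    abel
  have hn : ‖p - q‖ * ‖p - q‖ = ‖p - q‖ := by
    rw [← CStarRing.norm_star_mul_self, hsq]
  have : ‖p - q‖ = 0 := by
    by_contra hne
    exact h.ne (mul_right_cancel₀ hne (by rw [hn, one_mul]))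
  exact sub_eq_zero.1 (norm_eq_zero.1 this)

end MatrixUnits

/-! ### Lifting matrix units to a neighbourhood -/

section LocalFrames

open scoped Matrix.Norms.L2Operator

variable {A : Type u} [NonUnitalCStarAlgebra A] {T : Type v} [TopologicalSpace T]
  {θ : T ≃ₜ PrimitiveSpectrum A} {n : ℕ}

theorem single_eq_diagonal {n : ℕ} (i : Fin n) :
    (Matrix.single i i 1 : M n) = Matrix.diagonal fun k => if k = i then 1 else 0 := by
  ext k l
  by_cases h : k = l
  · subst h; simp [Matrix.single_apply, eq_comm]
  · rw [Matrix.diagonal_apply_ne _ h, Matrix.single_apply_of_ne]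
    rintro ⟨rfl, rfl⟩; exact h rfl

/-- Composition of a representation with an automorphism of `Mₙ`. -/
def Rep.conj (g : M n ≃⋆ₐ[ℂ] M n) (x : Rep θ n) : Rep θ n where
  base := x.base
  hom := g.toNonUnitalStarAlgHom.comp x.hom
  ker_hom := by
    rw [← x.ker_hom]
    ext a
    simp only [TwoSidedIdeal.mem_ker]
    exact map_eq_zero_iff g g.injective

theorem Rep.conj_hom_apply (g : M n ≃⋆ₐ[ℂ] M n) (x : Rep θ n) (a : A) :
    (x.conj g).hom a = g (x.hom a) := rfl

/-- Near every point there are matrix units; the diagonal ones can be taken from the functional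
calculus of a given element with spectrum `{1, …, n}` at the point. -/
theorem exists_local_frame [T2Space T] (hn : 1 ≤ n) (hA : IsHomogeneous A n) (x : Rep θ n)
    {h : A} (hh : IsSelfAdjoint h) (hx : x.hom h = Matrix.diagonal fun i : Fin n => ((i : ℕ) : ℂ) + 1) :
    ∃ (e : Fin n → Fin n → A) (U : Set T), IsOpen U ∧ x.base ∈ U ∧ ∀ t ∈ U, ∃ y : Rep θ n,
      y.base = t ∧ (∀ i j, y.hom (e i j) = Matrix.single i j 1) ∧
      ∀ i : Fin n, y.hom (cfcₙ (bump i) h) = Matrix.single i i 1 := by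
  let o : Fin n := ⟨0, hn⟩
  let p : Fin n → A := fun i => cfcₙ (bump i) h
  have hpsa : ∀ i, IsSelfAdjoint (p i) := fun i => cfcₙ_predicate _ _
  have hpp : ∀ i j, i ≠ j → p i * p j = 0 := fun i j hij =>
    cfcₙ_bump_mul h (fun h' => hij (Fin.ext h'))
  have hxp : ∀ i, x.hom (p i) = Matrix.single i i 1 := by
    intro i
    rw [map_cfcₙ_real _ (continuous_bump i) (bump_zero i) hh, hx, single_eq_diagonal]
    simp only [Fin.ext_iff]
    exact cfcₙ_bump_hom_pi (diagonalHom n) i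
  choose X hX using fun j : Fin n => x.surjective hn hA (Matrix.single j o 1)
  -- Lifts of the first column of matrix units, cut down by the projections so that different `v j`
  -- have orthogonal ranges; normalizing them gives partial isometries `w j` near the point.
  let v : Fin n → A := fun j => p j * X j * p o
  have hxv : ∀ j, x.hom (v j) = Matrix.single j o 1 := by
    intro j
    simp [v, hxp, hX]
  let c : Fin n → A := fun j => star (v j) * v j
  have hcsa : ∀ j, IsSelfAdjoint (c j) := fun j => .star_mul_self _
  have hxc : ∀ j, x.hom (c j) = Matrix.single o o 1 := by
    intro j
    simp [c, hxv, map_star, Matrix.star_eq_conjTranspose]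
  let q : Fin n → A := fun j => cfcₙ (bump 0) (c j)
  have hxq : ∀ j, x.hom (q j) = Matrix.single o o 1 := by
    intro j
    rw [map_cfcₙ_real _ (continuous_bump 0) (bump_zero 0) (hcsa j), hxc, single_eq_diagonal]
    have := cfcₙ_diagonal (continuous_bump 0) (bump_zero 0)
      (fun k : Fin n => (if k = o then 1 else 0 : ℝ))
    have h1 : bump 0 1 = 1 := bump_eq_one (by norm_num)
    simp only [apply_ite (bump 0), h1, bump_zero] at this
    simpa only [apply_ite Complex.ofReal, Complex.ofReal_one, Complex.ofReal_zero] using this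
  let r : Fin n → A := fun j => cfcₙ invSqrtBump (c j)
  have hrsa : ∀ j, IsSelfAdjoint (r j) := fun j => cfcₙ_predicate _ _
  have hrcr : ∀ j, r j * c j * r j = q j * q j := by
    intro j
    have h1 : c j = cfcₙ (id : ℝ → ℝ) (c j) := (cfcₙ_id ℝ (c j)).symm
    have h2 : r j * cfcₙ (id : ℝ → ℝ) (c j) * r j = q j * q j := by
      simp only [r, q]
      rw [← cfcₙ_mul _ _ _ continuous_invSqrtBump.continuousOn invSqrtBump_zero continuousOn_id rfl,
        ← cfcₙ_mul (fun s => invSqrtBump s * id s) _ _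
          (continuous_invSqrtBump.mul continuous_id).continuousOn (by simp)
          continuous_invSqrtBump.continuousOn invSqrtBump_zero,
        ← cfcₙ_mul _ _ _ (continuous_bump 0).continuousOn (bump_zero 0)
          (continuous_bump 0).continuousOn (bump_zero 0)]
      congr 1
      funext s
      exact invSqrtBump_mul s
    rwa [← h1] at h2
  let w : Fin n → A := fun j => v j * r j * p o
  obtain ⟨U₀, hU₀, hxU₀, hidem⟩ := exists_isOpen_bump_idem hn hA x hh (by
    rw [hx]
    have := cfcₙ_distInt_hom_pi (diagonalHom n) fun i : Fin n => (i : ℕ) + 1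
    push_cast at this
    exact this)
  have hex := fun j => exists_isOpen_bump_idem hn hA x (hcsa j) (by
    rw [hxc, single_eq_diagonal]
    have := cfcₙ_distInt_hom_pi (diagonalHom n) fun i : Fin n => if i = o then 1 else 0
    push_cast at this
    exact this)
  choose U₁ hU₁ hxU₁ hidem₁ using hex
  -- Over this set, `q j`, which sits below `p o`, is at distance less than one from it; once both
  -- are projections they are equal. `U₃` keeps `p o` nonzero.
  let U₂ : Fin n → Set T := fun j => {t | ∀ y : Rep θ n, y.base = t → ‖y.hom (p o - q j)‖ < 1}
  have hU₂ : ∀ j, IsOpen (U₂ j) := fun j => Rep.isOpen_norm_lt hn hA _ _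
  have hxU₂ : ∀ j, x.base ∈ U₂ j := fun j y hy => by
    rw [Rep.norm_eq hn hA hy, map_sub, hxp, hxq, sub_self, norm_zero]
    exact one_pos
  let U₃ : Set T := {t | p o ∉ (θ t).1}
  have hxU₃ : x.base ∈ U₃ := fun hmem => by
    have h1 := (x.hom_eq_zero_iff _).2 hmem
    rw [hxp] at h1
    have := congrFun (congrFun h1 o) o
    simp at this
  refine ⟨fun i j => w i * star (w j), U₀ ∩ (⋂ j, U₁ j) ∩ (⋂ j, U₂ j) ∩ U₃,
    ((hU₀.inter (isOpen_iInter_of_finite hU₁)).inter (isOpen_iInter_of_finite hU₂)).inter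
      (Rep.isOpen_notMem θ _),
    ⟨⟨⟨hxU₀, Set.mem_iInter.2 hxU₁⟩, Set.mem_iInter.2 hxU₂⟩, hxU₃⟩, ?_⟩
  rintro t ⟨⟨⟨ht₀, ht₁⟩, ht₂⟩, ht₃⟩
  rw [Set.mem_iInter] at ht₁ ht₂
  obtain ⟨y, rfl⟩ := Rep.exists_base_eq (θ := θ) hn hA t
  have hP : ∀ i, y.hom (p i) * y.hom (p i) = y.hom (p i) := fun i => hidem y ht₀ i
  have hPsa : ∀ i, star (y.hom (p i)) = y.hom (p i) := fun i => ((hpsa i).map y.hom).star_eq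
  have hvP : ∀ j, y.hom (v j) * y.hom (p o) = y.hom (v j) := fun j => by
    simp only [v, map_mul, mul_assoc, hP]
  have hPv : ∀ j, y.hom (p j) * y.hom (v j) = y.hom (v j) := fun j => by
    simp only [v, map_mul, ← mul_assoc, hP]
  have hQ : ∀ j, y.hom (p o) = y.hom (q j) := by
    intro j
    refine eq_of_norm_sub_lt_one ((hpsa o).map y.hom)
      (show IsSelfAdjoint (y.hom (q j)) from (cfcₙ_predicate _ _ : IsSelfAdjoint (q j)).map y.hom)
      (hP o) (hidem₁ j y (ht₁ j) 0) ?_ ?_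
    · rw [map_cfcₙ_real _ (continuous_bump 0) (bump_zero 0) (hcsa j)]
      refine cfcₙ_bump_mul_of_mul_eq ((hcsa j).map y.hom) ?_
      simp only [c, map_mul, mul_assoc, hvP]
    · rw [← map_sub]
      exact ht₂ j y rfl
  have hww : ∀ j k, star (y.hom (w j)) * y.hom (w k) = if j = k then y.hom (p o) else 0 := by
    intro j k
    rw [← map_star, ← map_mul]
    have e1 : star (w j) * w k = p o * (r j * (star (v j) * v k) * r k) * p o := by
      simp only [w, star_mul, (hpsa o).star_eq, (hrsa j).star_eq, mul_assoc]
    split_ifs with hjk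
    · subst hjk
      rw [e1, show star (v j) * v j = c j from rfl, hrcr, map_mul, map_mul, map_mul, ← hQ]
      simp only [hP]
    · have e2 : star (v j) * v k = 0 := by
        have : star (v j) * v k = p o * star (X j) * (p j * p k) * X k * p o := by
          simp only [v, star_mul, (hpsa o).star_eq, (hpsa j).star_eq, mul_assoc]
        rw [this, hpp j k hjk]
        simp
      rw [e1, e2]
      simp
  have hwP : ∀ j, y.hom (w j) * y.hom (p o) = y.hom (w j) := fun j => by
    simp only [w, map_mul, mul_assoc, hP]
  have hPw : ∀ j, y.hom (p j) * y.hom (w j) = y.hom (w j) := fun j => by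
    simp only [w, map_mul, ← mul_assoc, hPv]
  have hPo : y.hom (p o) ≠ 0 := fun h0 => ht₃ ((y.hom_eq_zero_iff _).1 h0)
  obtain ⟨g, hg⟩ := exists_starAlgEquiv_single (fun i j => y.hom (w i * star (w j)))
    (fun i j k l => by
      have : y.hom (w i * star (w j)) * y.hom (w k * star (w l)) =
          y.hom (w i) * (star (y.hom (w j)) * y.hom (w k)) * star (y.hom (w l)) := by
        simp only [map_mul, map_star, mul_assoc]
      rw [this, hww]
      split_ifs
      · rw [hwP, map_mul y.hom (w i), map_star]
      · simp)
    (fun i j => by rw [← map_star, star_mul, star_star])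
    (fun i h0 => by
      have h1 : y.hom (w i) = 0 := by
        rw [map_mul, map_star] at h0
        exact CStarRing.mul_star_self_eq_zero_iff _ |>.1 h0
      have h2 := hww i i
      rw [h1, mul_zero, if_pos rfl] at h2
      exact hPo h2.symm)
  have hgs : ∀ i j, g.symm (y.hom (w i * star (w j))) = Matrix.single i j 1 := fun i j => by
    rw [← hg, StarAlgEquiv.symm_apply_apply]
  refine ⟨y.conj g.symm, rfl, hgs, fun i => ?_⟩
  rw [Rep.conj_hom_apply]
  change g.symm (y.hom (p i)) = _
  -- The new diagonal units sum to `1` and satisfy `e k k = p k * e k k`, so multiplying `p i` by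
  -- this sum leaves only `e i i`.
  rw [← mul_one (g.symm (y.hom (p i))), ← Matrix.sum_single_one, Finset.mul_sum,
    Finset.sum_eq_single i]
  · rw [← hgs, ← map_mul, map_mul y.hom, ← mul_assoc, hPw]
  · intro k _ hk
    rw [← hgs, ← map_mul, map_mul y.hom, ← hPw k, ← mul_assoc, ← mul_assoc, ← map_mul y.hom,
      hpp i k hk.symm]
    simp
  · simp

end LocalFrames

/-! ### Central elements -/

section Central

open scoped Matrix.Norms.L2Operator

variable {A : Type u} [NonUnitalCStarAlgebra A] {T : Type v} [TopologicalSpace T]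
  {θ : T ≃ₜ PrimitiveSpectrum A} {n : ℕ}

namespace Rep

/-- Elements vanishing off an open set detect its points. -/
theorem exists_notMem_of_isOpen (hn : 1 ≤ n) (hA : IsHomogeneous A n)
    {V : Set (PrimitiveSpectrum A)} (hV : IsOpen V) :
    ∀ P ∈ V, ∃ a, a ∉ P.1 ∧ ∀ Q ∉ V, a ∈ Q.1 := by
  have hrep : ∀ P : PrimitiveSpectrum A, ∃ φ : A →⋆ₙₐ[ℂ] M n, Function.Surjective φ ∧
      ∀ a, a ∈ P.1 ↔ φ a = 0 := by
    intro P
    obtain ⟨φ, h0, hφ⟩ := exists_hom_of_isPrimitiveIdeal hn hA P.2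
    exact ⟨φ, surjective_of_isHomogeneous hn hA φ h0, fun a => by
      rw [← hφ, TwoSidedIdeal.mem_ker]⟩
  have hone : (1 : M n) ≠ 0 := by
    have : Nonempty (Fin n) := ⟨⟨0, hn⟩⟩
    exact one_ne_zero
  induction hV with
  | basic s hs =>
    obtain ⟨a, rfl⟩ := hs
    exact fun P hP => ⟨a, hP, fun Q hQ => not_not.1 hQ⟩
  | univ =>
    intro P _
    obtain ⟨φ, hs, hφ⟩ := hrep P
    obtain ⟨a, ha⟩ := hs 1
    exact ⟨a, by rw [hφ, ha]; exact hone, fun Q hQ => absurd (Set.mem_univ Q) hQ⟩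
  | inter s t _ _ ihs iht =>
    intro P hP
    obtain ⟨a, ha, ha'⟩ := ihs P hP.1
    obtain ⟨b, hb, hb'⟩ := iht P hP.2
    obtain ⟨φ, hs, hφ⟩ := hrep P
    rw [hφ] at ha hb
    -- Matrix algebras are prime: a matrix unit placed between nonzero entries of `φ a` and `φ b`
    -- gives a nonzero product.
    obtain ⟨c, hc⟩ : ∃ c, φ (a * c * b) ≠ 0 := by
      by_contra! h
      obtain ⟨i, j, hij⟩ : ∃ i j, φ a i j ≠ 0 := by
        by_contra! h'; exact ha (Matrix.ext h')
      obtain ⟨k, l, hkl⟩ : ∃ k l, φ b k l ≠ 0 := by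
        by_contra! h'; exact hb (Matrix.ext h')
      obtain ⟨c, hc⟩ := hs (Matrix.single j k 1)
      have h1 := h c
      rw [map_mul, map_mul, hc] at h1
      have h2 := congrFun (congrFun h1 i) l
      rw [Matrix.mul_apply, Finset.sum_eq_single k] at h2
      · rw [Matrix.mul_single_apply_same] at h2
        simp [hij, hkl] at h2
      · intro p _ hp
        rw [Matrix.mul_single_apply_of_ne _ _ _ _ _ hp, zero_mul]
      · simp
    refine ⟨a * c * b, by rwa [hφ], fun Q hQ => ?_⟩
    by_cases hQs : Q ∈ s
    · exact Q.1.mul_mem_left _ _ (hb' Q fun h => hQ ⟨hQs, h⟩)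
    · exact Q.1.mul_mem_right _ _ (Q.1.mul_mem_right _ _ (ha' Q hQs))
  | sUnion S _ ih =>
    rintro P ⟨s, hs, hP⟩
    obtain ⟨a, ha, ha'⟩ := ih s hs P hP
    exact ⟨a, ha, fun Q hQ => ha' Q fun h => hQ ⟨s, hs, h⟩⟩

/-- Every matrix is the value at a given point of an element supported in a given
neighbourhood. -/
theorem exists_hom_eq_supported (hn : 1 ≤ n) (hA : IsHomogeneous A n) (x : Rep θ n) {U : Set T}
    (hU : IsOpen U) (hx : x.base ∈ U) (m : M n) :
    ∃ d, x.hom d = m ∧ ∀ y : Rep θ n, y.base ∉ U → y.hom d = 0 := by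
  obtain ⟨a, ha, ha'⟩ := exists_notMem_of_isOpen hn hA (hU.preimage θ.symm.continuous) (θ x.base)
    (by simpa using hx)
  let I : Submodule ℂ A :=
    { carrier := {d | ∀ y : Rep θ n, y.base ∉ U → y.hom d = 0}
      add_mem' := fun {d d'} hd hd' y hy => by rw [map_add, hd y hy, hd' y hy, add_zero]
      zero_mem' := fun y _ => map_zero _
      smul_mem' := fun c d hd y hy => by rw [map_smul, hd y hy, smul_zero] }
  have haI : a ∈ I := fun y hy => (y.hom_eq_zero_iff a).2 (ha' _ (by simpa using hy))
  -- The elements supported in `U` form an ideal whose image at `x` is nonzero, hence all of `Mₙ`.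
  have htop := eq_top_of_ideal (I.map (x.hom : A →ₗ[ℂ] M n)) (fun z y hy => by
      obtain ⟨d, hd, rfl⟩ := hy
      obtain ⟨b, rfl⟩ := x.surjective hn hA z
      exact ⟨b * d, fun y hy => by rw [map_mul, hd y hy, mul_zero], map_mul x.hom b d⟩)
    (fun z y hy => by
      obtain ⟨d, hd, rfl⟩ := hy
      obtain ⟨b, rfl⟩ := x.surjective hn hA z
      exact ⟨d * b, fun y hy => by rw [map_mul, hd y hy, zero_mul], map_mul x.hom d b⟩)
    ⟨a, haI, rfl⟩ (fun h => ha ((x.hom_eq_zero_iff a).1 h))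
  obtain ⟨d, hd, rfl⟩ := htop.ge (Submodule.mem_top (x := m))
  exact ⟨d, rfl, hd⟩

theorem exists_selfAdjoint_hom_eq (x : Rep θ n) {B : NonUnitalStarSubalgebra ℂ A} {m : M n}
    (hm : IsSelfAdjoint m) (hB : m ∈ x.hom '' (B : Set A)) :
    ∃ h ∈ B, IsSelfAdjoint h ∧ x.hom h = m := by
  obtain ⟨b, hb, rfl⟩ := hB
  refine ⟨(1 / 2 : ℝ) • (b + star b), ?_, ?_, ?_⟩
  · have : ((1 / 2 : ℝ) • (b + star b)) = ((1 / 2 : ℝ) : ℂ) • (b + star b) :=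
      (Complex.coe_smul _ _).symm
    rw [this]
    exact SMulMemClass.smul_mem _ (add_mem hb (star_mem hb))
  · exact (IsSelfAdjoint.all (1 / 2 : ℝ)).smul (IsSelfAdjoint.add_star_self b)
  · rw [← Complex.coe_smul, map_smul, map_add, map_star, hm.star_eq, ← two_smul ℂ, smul_smul]
    norm_num

/-- Take `d` supported near `x` with value `e o o` there. Then `∑ i, e i o * d * e o i` is, where
the matrix units are valid, the scalar given by the `(o, o)` entry of `d`; elsewhere `d` vanishes.
-/
theorem exists_central [T2Space T] (hn : 1 ≤ n) (hA : IsHomogeneous A n) (x : Rep θ n) {U : Set T}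
    (hU : IsOpen U) (hx : x.base ∈ U) :
    ∃ (z : A) (c : T → ℝ), IsSelfAdjoint z ∧
      (∀ y : Rep θ n, y.hom z = (c y.base : ℂ) • (1 : M n)) ∧ (∀ t, 0 ≤ c t) ∧ c x.base = 1 ∧
      ∀ t ∉ U, c t = 0 := by
  let o : Fin n := ⟨0, hn⟩
  obtain ⟨h, -, hh, hxh⟩ := x.exists_selfAdjoint_hom_eq (B := ⊤)
    (m := Matrix.diagonal fun i : Fin n => ((i : ℕ) : ℂ) + 1) (by
      rw [IsSelfAdjoint, Matrix.star_eq_conjTranspose, Matrix.diagonal_conjTranspose]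
      congr 1
      funext i
      simp) (by
      obtain ⟨a, ha⟩ := x.surjective hn hA (Matrix.diagonal fun i : Fin n => ((i : ℕ) : ℂ) + 1)
      exact ⟨a, trivial, ha⟩)
  obtain ⟨e, U', hU', hxU', he⟩ := exists_local_frame hn hA x hh hxh
  obtain ⟨x', hx', hx'e, -⟩ := he x.base hxU'
  obtain ⟨d, hd, hd'⟩ := exists_hom_eq_supported hn hA x' (hU.inter hU') (by rw [hx']; exact ⟨hx, hxU'⟩)
    (Matrix.single o o 1)
  let z₀ : A := ∑ i, e i o * d * e o i
  have hscal : ∀ y : Rep θ n, (∀ i j, y.hom (e i j) = Matrix.single i j 1) →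
      y.hom z₀ = (y.hom d o o) • (1 : M n) := by
    intro y hy
    have : (1 : M n) = ∑ i, Matrix.single i i 1 := Matrix.sum_single_one.symm
    simp only [z₀, map_sum, map_mul, hy]
    rw [this, Finset.smul_sum]
    refine Finset.sum_congr rfl fun i _ => ?_
    rw [Matrix.single_mul_mul_single]
    simp
  have key : ∀ t : T, ∃ c : ℂ, (∀ y : Rep θ n, y.base = t → y.hom z₀ = c • (1 : M n)) ∧
      (t = x.base → c = 1) ∧ (t ∉ U → c = 0) := by
    intro t
    by_cases ht : t ∈ U ∩ U'
    · obtain ⟨y', hy't, hy'⟩ := he t ht.2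
      refine ⟨y'.hom d o o, fun y hy => ?_, fun htx => ?_, fun h => absurd ht.1 h⟩
      · obtain ⟨g, hg⟩ := exists_equiv hn hA (hy't.trans hy.symm)
        rw [← hg, hscal y' hy'.1, map_smul, map_one]
      · obtain ⟨g, hg⟩ := exists_equiv hn hA (hx'.trans (htx.symm.trans hy't.symm))
        have h1 : g (x'.hom z₀) = y'.hom z₀ := hg _
        rw [hscal x' hx'e, hscal y' hy'.1, map_smul, map_one, hd] at h1
        have h2 := congrFun (congrFun h1 o) o
        simpa using h2.symm
    · refine ⟨0, fun y hy => ?_, fun htx => absurd ⟨htx ▸ hx, htx ▸ hxU'⟩ ht, fun _ => rfl⟩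
      have : y.hom d = 0 := hd' y (by rwa [hy])
      simp [z₀, this]
  choose c hc hc1 hc0 using key
  -- Replacing `z₀` by `z₀* z₀` makes the scalars real and nonnegative.
  refine ⟨star z₀ * z₀, fun t => ‖c t‖ ^ 2, .star_mul_self _, fun y => ?_, fun t => by positivity,
    by simp [hc1 _ rfl], fun t ht => by simp [hc0 t ht]⟩
  rw [map_mul, map_star, hc _ y rfl, star_smul, star_one, smul_mul_smul_comm, one_mul]
  congr 1
  rw [mul_comm]
  have := Complex.mul_conj' (c y.base)
  push_cast
  exact this

/-- Partitions of unity by central elements. -/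
theorem exists_partition [T2Space T] (hn : 1 ≤ n) (hA : IsHomogeneous A n)
    (θ : T ≃ₜ PrimitiveSpectrum A) {K : Set T} (hK : IsCompact K)
    {V : T → Set T} (hV : ∀ t ∈ K, IsOpen (V t)) (hVt : ∀ t ∈ K, t ∈ V t) :
    ∃ (s : Finset T) (z : T → A) (c : T → T → ℝ), ↑s ⊆ K ∧
      (∀ t ∈ s, ∀ y : Rep θ n, y.hom (z t) = (c t y.base : ℂ) • (1 : M n)) ∧
      (∀ t ∈ s, ∀ u, 0 ≤ c t u) ∧ (∀ t ∈ s, ∀ u ∉ V t, c t u = 0) ∧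
      (∀ u, ∑ t ∈ s, c t u ≤ 1) ∧ ∀ u ∈ K, ∑ t ∈ s, c t u = 1 := by
  have hone : ‖(1 : M n)‖ = 1 := by
    have : Nonempty (Fin n) := ⟨⟨0, hn⟩⟩
    exact norm_one
  have hex : ∀ t, ∃ (z : A) (c : T → ℝ), t ∈ K → IsSelfAdjoint z ∧
      (∀ y : Rep θ n, y.hom z = (c y.base : ℂ) • (1 : M n)) ∧ (∀ u, 0 ≤ c u) ∧ c t = 1 ∧
      ∀ u ∉ V t, c u = 0 := by
    intro t
    by_cases ht : t ∈ K
    · obtain ⟨x, rfl⟩ := exists_base_eq (θ := θ) hn hA t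
      obtain ⟨z, c, h⟩ := exists_central hn hA x (hV _ ht) (hVt _ ht)
      exact ⟨z, c, fun _ => h⟩
    · exact ⟨0, 0, fun h => absurd h ht⟩
  choose z c hz using hex
  let W : T → Set T := fun t => {u | ∀ y : Rep θ n, y.base = u → 1 / 2 < ‖y.hom (z t)‖}
  have hW : ∀ t, IsOpen (W t) := fun t =>
    isOpen_base_image hn hA (isOpen_lt continuous_const (continuous_hom_apply _).norm)
      fun _ _ h hx => norm_eq hn hA h (z t) ▸ hx
  have hnorm : ∀ t ∈ K, ∀ y : Rep θ n, ‖y.hom (z t)‖ = c t y.base := by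
    intro t ht y
    rw [(hz t ht).2.1, norm_smul, hone, mul_one, Complex.norm_real,
      Real.norm_of_nonneg ((hz t ht).2.2.1 _)]
  obtain ⟨s, hsK, hcov⟩ := hK.elim_nhds_subcover W fun t ht => (hW t).mem_nhds fun y hy => by
    rw [hnorm t ht, hy, (hz t ht).2.2.2.1]; norm_num
  -- The normalizing factor: `r * R r` equals `1` for `1/2 ≤ r` and is at most `1` for all `0 ≤ r`,
  -- while `R 0 = 0`. On `K` the sum of the bumps exceeds `1/2`.
  let R : ℝ → ℝ := fun r => r * ((max r (1 / 2)) ^ 2)⁻¹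
  have hpos : ∀ r : ℝ, 0 < max r (1 / 2) := fun r => lt_max_of_lt_right (by norm_num)
  have hR : Continuous R := continuous_id.mul (Continuous.inv₀ (by fun_prop) fun r =>
    (pow_pos (hpos r) 2).ne')
  have hR0 : R 0 = 0 := zero_mul _
  have hRnn : ∀ r, 0 ≤ r → 0 ≤ R r := fun r hr => mul_nonneg hr (by have := hpos r; positivity)
  have hRle : ∀ r, 0 ≤ r → r * R r ≤ 1 := by
    intro r hr
    have h1 : r * R r = r ^ 2 / (max r (1 / 2)) ^ 2 := by simp only [R]; field_simp
    rw [h1, div_le_one (pow_pos (hpos r) 2)]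
    exact pow_le_pow_left₀ hr (le_max_left _ _) 2
  have hR1 : ∀ r, 1 / 2 ≤ r → r * R r = 1 := by
    intro r hr
    have : r ≠ 0 := by linarith
    simp only [R, max_eq_left hr]
    field_simp
  let w : A := ∑ t ∈ s, z t
  have hw : IsSelfAdjoint w := isSelfAdjoint_sum _ fun t ht => (hz t (hsK t ht)).1
  let C : T → ℝ := fun u => ∑ t ∈ s, c t u
  have hC : ∀ u, 0 ≤ C u := fun u => Finset.sum_nonneg fun t ht => (hz t (hsK t ht)).2.2.1 u
  have hyw : ∀ y : Rep θ n, y.hom w = algebraMap ℝ (M n) (C y.base) := by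
    intro y
    rw [map_sum, Finset.sum_congr rfl fun t ht => (hz t (hsK t ht)).2.1 y, ← Finset.sum_smul,
      Algebra.algebraMap_eq_smul_one, ← Complex.coe_smul]
    simp [C]
  have hyR : ∀ y : Rep θ n, y.hom (cfcₙ R w) = ((R (C y.base) : ℝ) : ℂ) • (1 : M n) := by
    intro y
    rw [map_cfcₙ_real _ hR hR0 hw, hyw, cfcₙ_algebraMap_real hR hR0,
      Algebra.algebraMap_eq_smul_one, Complex.coe_smul]
  refine ⟨s, fun t => z t * cfcₙ R w, fun t u => c t u * R (C u), hsK, fun t ht y => ?_,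
    fun t ht u => mul_nonneg ((hz t (hsK t ht)).2.2.1 u) (hRnn _ (hC u)), fun t ht u hu => ?_,
    fun u => ?_, fun u hu => ?_⟩
  · rw [map_mul, (hz t (hsK t ht)).2.1, hyR, smul_mul_smul_comm, one_mul]
    push_cast
    rfl
  · beta_reduce
    rw [(hz t (hsK t ht)).2.2.2.2 u hu, zero_mul]
  · rw [← Finset.sum_mul]
    exact hRle _ (hC u)
  · rw [← Finset.sum_mul]
    refine hR1 _ ?_
    obtain ⟨t, ht, hu'⟩ := Set.mem_iUnion₂.1 (hcov hu)
    obtain ⟨y, rfl⟩ := exists_base_eq (θ := θ) hn hA u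
    have h1 := hu' y rfl
    rw [hnorm t (hsK t ht)] at h1
    exact h1.le.trans (Finset.single_le_sum (f := fun t => c t y.base)
      (fun t ht => (hz t (hsK t ht)).2.2.1 _) ht)

/-- Central elements with values in `[0, 1]`, supported near a point. -/
theorem exists_central_le_one [T2Space T] (hn : 1 ≤ n) (hA : IsHomogeneous A n) (x : Rep θ n)
    {U : Set T} (hU : IsOpen U) (hx : x.base ∈ U) :
    ∃ (z : A) (c : T → ℝ), (∀ y : Rep θ n, y.hom z = (c y.base : ℂ) • (1 : M n)) ∧
      (∀ t, 0 ≤ c t) ∧ (∀ t, c t ≤ 1) ∧ c x.base = 1 ∧ ∀ t ∉ U, c t = 0 := by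
  obtain ⟨s, z, c, hs, hz, hc0, hcU, hle, h1⟩ := exists_partition (n := n) hn hA θ
    (isCompact_singleton (x := x.base)) (V := fun _ => U) (fun _ _ => hU) (fun t ht => by
      rw [Set.mem_singleton_iff.1 ht]; exact hx)
  refine ⟨∑ t ∈ s, z t, fun u => ∑ t ∈ s, c t u, fun y => ?_,
    fun u => Finset.sum_nonneg fun t ht => hc0 t ht u, hle, h1 _ rfl,
    fun u hu => Finset.sum_eq_zero fun t ht => hcU t ht u hu⟩
  rw [map_sum, Finset.sum_congr rfl fun t ht => hz t ht y, ← Finset.sum_smul]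
  simp

/-- Such an element is central, so maximality puts it in `B`. -/
theorem mem_of_scalar (hn : 1 ≤ n) (hA : IsHomogeneous A n) {B : NonUnitalStarSubalgebra ℂ A}
    (hB : IsCartanSubalgebra B) {z : A} {c : T → ℝ}
    (hz : ∀ y : Rep θ n, y.hom z = (c y.base : ℂ) • (1 : M n)) : z ∈ B := by
  rw [hB.maximalAbelian]
  intro b _
  refine eq_of_forall_hom (θ := θ) hn hA fun y => ?_
  rw [map_mul, map_mul, hz, smul_mul_assoc, mul_smul_comm, one_mul, mul_one]

/-- A conditional expectation onto a Cartan subalgebra preserves the primitive ideals. -/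
theorem hom_expectation_eq_zero [T2Space T] (hn : 1 ≤ n) (hA : IsHomogeneous A n)
    {B : NonUnitalStarSubalgebra ℂ A} (hB : IsCartanSubalgebra B) {E : A →ₗ[ℂ] A}
    (hE : IsConditionalExpectation B E) (x : Rep θ n) {a : A} (ha : x.hom a = 0) :
    x.hom (E a) = 0 := by
  rw [← norm_le_zero_iff]
  refine le_of_forall_pos_le_add fun ε hε => ?_
  rw [zero_add]
  obtain ⟨z, c, hz, hc0, hc1, hcx, hcU⟩ := exists_central_le_one hn hA x
    (isOpen_norm_lt (θ := θ) hn hA a ε) (fun y hy => by rwa [norm_eq hn hA hy, ha, norm_zero])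
  have hzB := mem_of_scalar hn hA hB hz
  have hval : ∀ (y : Rep θ n) b, y.hom (z * b * z) = ((c y.base * c y.base : ℝ) : ℂ) • y.hom b := by
    intro y b
    rw [map_mul, map_mul, hz, smul_mul_assoc, one_mul, mul_smul_comm, mul_one, smul_smul]
    push_cast
    rfl
  -- As `z` lies in `B` and is `1` at `x`, replacing `a` by `z a z` does not change the value of `E
  -- a` at `x`. Where `z` is nonzero `a` has norm below `ε`, so `‖z a z‖ ≤ ε` and contractivity of
  -- `E` finishes.
  have h1 : x.hom (E a) = x.hom (E (z * a * z)) := by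
    rw [hE.map_mul_mul z hzB z hzB, hval, hcx]
    simp
  rw [h1]
  refine (NonUnitalStarAlgHom.norm_apply_le x.hom _).trans ((hE.contractive _).trans ?_)
  refine norm_le_of_forall_hom (θ := θ) hn hA hε.le fun y => ?_
  rw [hval, norm_smul, Complex.norm_real, Real.norm_of_nonneg (mul_nonneg (hc0 _) (hc0 _))]
  by_cases hy : y.base ∈ {t | ∀ x : Rep θ n, x.base = t → ‖x.hom a‖ < ε}
  · have h2 := hy y rfl
    have h3 : c y.base * c y.base ≤ 1 := mul_le_one₀ (hc1 _) (hc0 _) (hc1 _)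
    calc _ ≤ 1 * ‖y.hom a‖ := by gcongr
      _ ≤ ε := by linarith
  · rw [hcU _ hy]
    simpa using hε.le

end Rep

end Central

/-! ### The fibres of a Cartan subalgebra are maximal abelian -/

section Fibres

open scoped Matrix.Norms.L2Operator

/-- A finite-dimensional reduced commutative complex algebra is a power of `ℂ`. -/
theorem exists_algEquiv_pi (R : Type*) [CommRing R] [Algebra ℂ R] [Module.Finite ℂ R]
    [IsReduced R] : ∃ k, Nonempty (R ≃ₐ[ℂ] (Fin k → ℂ)) := by
  have : IsArtinianRing R := IsArtinianRing.of_finite ℂ R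
  let _ := Fintype.ofFinite (MaximalSpectrum R)
  let e₁ : R ≃ₐ[ℂ] ∀ I : MaximalSpectrum R, R ⧸ I.asIdeal :=
    (IsArtinianRing.equivPi R).restrictScalars ℂ
  have hb : ∀ I : MaximalSpectrum R, Function.Bijective (algebraMap ℂ (R ⧸ I.asIdeal)) := by
    intro I
    have := I.isMaximal
    have : IsDomain (R ⧸ I.asIdeal) := inferInstance
    have : Algebra.IsIntegral ℂ (R ⧸ I.asIdeal) := inferInstance
    exact IsAlgClosed.algebraMap_bijective_of_isIntegral
  let e₂ : (∀ I : MaximalSpectrum R, R ⧸ I.asIdeal) ≃ₐ[ℂ] (MaximalSpectrum R → ℂ) :=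
    AlgEquiv.piCongrRight fun I => (AlgEquiv.ofBijective (Algebra.ofId ℂ _) (hb I)).symm
  let e₃ : (MaximalSpectrum R → ℂ) ≃ₐ[ℂ] (Fin (Fintype.card (MaximalSpectrum R)) → ℂ) :=
    AlgEquiv.piCongrLeft ℂ (fun _ => ℂ) (Fintype.equivFin _)
  exact ⟨_, ⟨(e₁.trans e₂).trans e₃⟩⟩

/-- A unital commutative `*`-subalgebra of `Mₙ` is the range of a `*`-homomorphism from `ℂᵏ`. -/
theorem exists_hom_pi_range {n : ℕ} (C : StarSubalgebra ℂ (M n))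
    (hC : ∀ a ∈ C, ∀ b ∈ C, a * b = b * a) :
    ∃ (k : ℕ) (ψ : (Fin k → ℂ) →⋆ₙₐ[ℂ] M n), ψ 1 = 1 ∧ Set.range ψ = C := by
  have hfin : Module.Finite ℂ C.toSubalgebra.toSubmodule := inferInstance
  let _ : CommRing C :=
    { (inferInstance : Ring C) with mul_comm := fun a b => Subtype.ext (hC a a.2 b b.2) }
  -- Elements of `C` are normal, and a normal nilpotent is zero.
  have hsq : ∀ a ∈ C, a * a = 0 → a = 0 := by
    intro a ha h
    have h1 : star (star a * a) * (star a * a) = 0 := by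
      calc star (star a * a) * (star a * a) = star a * a * (a * star a) := by
            rw [star_mul, star_star, hC (star a) (star_mem ha) a ha]
        _ = star a * (a * a) * star a := by simp only [mul_assoc]
        _ = 0 := by rw [h, mul_zero, zero_mul]
    exact CStarRing.star_mul_self_eq_zero_iff a |>.1
      (CStarRing.star_mul_self_eq_zero_iff (star a * a) |>.1 h1)
  have : IsReduced C := by
    rw [isReduced_iff_pow_one_lt 2 one_lt_two]
    intro a ha
    rw [sq] at ha
    exact Subtype.ext (hsq a a.2 (congrArg Subtype.val ha))
  have : Module.Finite ℂ C := hfin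
  obtain ⟨k, ⟨e⟩⟩ := exists_algEquiv_pi C
  let q : Fin k → M n := fun j => (e.symm (Pi.single j 1) : C)
  have hqC : ∀ j, q j ∈ C := fun j => (e.symm (Pi.single j 1)).2
  have hqq : ∀ j, q j * q j = q j := fun j => by
    have : e.symm (Pi.single j 1) * e.symm (Pi.single j 1) = e.symm (Pi.single j 1) := by
      rw [← map_mul, ← Pi.single_mul, one_mul]
    exact congrArg Subtype.val this
  -- A normal idempotent is self-adjoint: `x = q - q*q` satisfies `x*x = 0`, so `q = q*q`.
  have hqs : ∀ j, star (q j) = q j := by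
    intro j
    have hss : star (q j) * star (q j) = star (q j) := by rw [← star_mul, hqq]
    have hc : q j * star (q j) = star (q j) * q j := hC _ (hqC j) _ (star_mem (hqC j))
    have h0 : q j - star (q j) * q j = 0 := by
      rw [← CStarRing.star_mul_self_eq_zero_iff]
      rw [star_sub, star_mul, star_star, sub_mul, mul_sub, mul_sub, ← mul_assoc, hss,
        mul_assoc, hqq, ← mul_assoc, mul_assoc (star (q j)) (q j), hc, ← mul_assoc, hss,
        mul_assoc, hqq]
      abel
    rw [sub_eq_zero] at h0
    conv_lhs => rw [h0]
    rw [star_mul, star_star, ← h0]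
  have hsum : ∀ l : Fin k → ℂ, ((e.symm l : C) : M n) = ∑ j, l j • q j := by
    intro l
    have : l = ∑ j, l j • (Pi.single j 1 : Fin k → ℂ) := by
      ext i
      simp [Finset.sum_apply, Pi.single_apply]
    conv_lhs => rw [this]
    rw [map_sum]
    simp only [map_smul]
    simp [q]
  let ψ : (Fin k → ℂ) →⋆ₙₐ[ℂ] M n :=
    { toFun := fun l => (e.symm l : C)
      map_smul' := fun c l => by rw [map_smul]; rfl
      map_zero' := by rw [map_zero]; rfl
      map_add' := fun l l' => by rw [map_add]; rfl
      map_mul' := fun l l' => by rw [map_mul]; rfl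
      map_star' := fun l => by
        rw [hsum, hsum, star_sum]
        simp only [star_smul, hqs]
        rfl }
  refine ⟨k, ψ, ?_, ?_⟩
  · change ((e.symm 1 : C) : M n) = 1
    rw [map_one]; rfl
  · ext a
    constructor
    · rintro ⟨l, rfl⟩
      exact (e.symm l).2
    · intro ha
      refine ⟨e ⟨a, ha⟩, ?_⟩
      change ((e.symm (e ⟨a, ha⟩) : C) : M n) = a
      rw [AlgEquiv.symm_apply_apply]

variable {A : Type u} [NonUnitalCStarAlgebra A] {T : Type v} [TopologicalSpace T]
  {θ : T ≃ₜ PrimitiveSpectrum A} {n : ℕ}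

/-- If the values of the elements of a set span at a point, then also nearby. -/
theorem exists_isOpen_span_eq_top [T2Space T] (hn : 1 ≤ n) (hA : IsHomogeneous A n) (x : Rep θ n)
    {S : Set A} (hS : Submodule.span ℂ (x.hom '' S) = ⊤) :
    ∃ U, IsOpen U ∧ x.base ∈ U ∧
      ∀ y : Rep θ n, y.base ∈ U → Submodule.span ℂ (y.hom '' S) = ⊤ := by
  obtain ⟨b, hbS, hspan, hli⟩ := exists_linearIndependent ℂ (x.hom '' S)
  rw [hS] at hspan
  have hfin : Finite b := hli.finite_of_isNoetherian
  let _ := Fintype.ofFinite b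
  choose a haS ha using fun m : b => hbS m.2
  have hcard : Fintype.card b = Module.finrank ℂ (M n) := by
    have hb := Module.Basis.mk hli (by rw [Subtype.range_coe, hspan])
    exact (Module.finrank_eq_card_basis hb).symm
  let Q : Rep θ n → Prop := fun y => LinearIndependent ℂ fun m => y.hom (a m)
  have hQ : IsOpen {y | Q y} := by
    have hcont : Continuous fun (y : Rep θ n) (m : b) => y.hom (a m) :=
      continuous_pi fun m => Rep.continuous_hom_apply (a m)
    exact (isOpen_setOfPred_linearIndependent (𝕜 := ℂ) (E := M n) (ι := b)).preimage hcont
  have hinv : ∀ y z : Rep θ n, y.base = z.base → Q y → Q z := by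
    intro y z hyz hy
    obtain ⟨g, hg⟩ := Rep.exists_equiv hn hA hyz
    have := hy.map' (g.toAlgEquiv.toLinearEquiv : M n →ₗ[ℂ] M n) (LinearEquiv.ker _)
    have heq : (fun m => z.hom (a m)) = fun m => g (y.hom (a m)) := funext fun m => (hg (a m)).symm
    change LinearIndependent ℂ fun m => z.hom (a m)
    rw [heq]
    exact this
  refine ⟨_, Rep.isOpen_base_image hn hA hQ hinv, fun y hy => hinv x y hy.symm ?_, fun y hy => ?_⟩
  · simpa only [Q, ha] using hli
  · have hy' : Q y := hy y rfl
    rw [eq_top_iff, ← hy'.span_eq_top_of_card_eq_finrank' hcard]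
    refine Submodule.span_mono ?_
    rintro _ ⟨m, rfl⟩
    exact ⟨a m, haS m, rfl⟩

/-- The image of a Cartan subalgebra in a fibre. -/
def fibre (x : Rep θ n) (B : NonUnitalStarSubalgebra ℂ A) (h1 : (1 : M n) ∈ x.hom '' (B : Set A)) :
    StarSubalgebra ℂ (M n) where
  carrier := x.hom '' (B : Set A)
  mul_mem' := by
    rintro _ _ ⟨a, ha, rfl⟩ ⟨b, hb, rfl⟩
    exact ⟨a * b, mul_mem ha hb, map_mul _ _ _⟩
  add_mem' := by
    rintro _ _ ⟨a, ha, rfl⟩ ⟨b, hb, rfl⟩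
    exact ⟨a + b, add_mem ha hb, map_add _ _ _⟩
  one_mem' := h1
  zero_mem' := ⟨0, zero_mem B, map_zero _⟩
  algebraMap_mem' c := by
    obtain ⟨a, ha, h⟩ := h1
    exact ⟨c • a, SMulMemClass.smul_mem c ha, by
      rw [map_smul, h, Algebra.algebraMap_eq_smul_one]⟩
  star_mem' := by
    rintro _ ⟨a, ha, rfl⟩
    exact ⟨star a, star_mem ha, map_star _ _⟩

/-- A central bump with value `1` at the point belongs to `B`. -/
theorem one_mem_image [T2Space T] (hn : 1 ≤ n) (hA : IsHomogeneous A n)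
    {B : NonUnitalStarSubalgebra ℂ A} (hB : IsCartanSubalgebra B) (x : Rep θ n) :
    (1 : M n) ∈ x.hom '' (B : Set A) := by
  obtain ⟨z, c, hz, -, -, hc, -⟩ :=
    Rep.exists_central_le_one hn hA x isOpen_univ (Set.mem_univ _)
  exact ⟨z, Rep.mem_of_scalar hn hA hB hz, by rw [hz, hc]; simp⟩

theorem bump_mem {B : NonUnitalStarSubalgebra ℂ A} (hB : IsCartanSubalgebra B) {h : A}
    (hh : h ∈ B) (j : ℕ) : cfcₙ (bump j) h ∈ B :=
  have := hB.isClosed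
  cfcₙ_mem (𝕜' := ℂ) (bump j) hh

/-- The fibres of a Cartan subalgebra contain their commutants, and can be diagonalized. -/
theorem exists_image_eq_diag [T2Space T] (hn : 1 ≤ n) (hA : IsHomogeneous A n)
    {B : NonUnitalStarSubalgebra ℂ A} (hB : IsCartanSubalgebra B) (x : Rep θ n) :
    ∃ g : M n ≃⋆ₐ[ℂ] M n, (x.conj g).hom '' (B : Set A) = diag n := by
  have h1 := one_mem_image hn hA hB x
  have hBcomm : ∀ a ∈ B, ∀ b ∈ B, a * b = b * a := fun a ha => (hB.maximalAbelian a).1 ha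
  obtain ⟨k, ψ, hψ1, hψ⟩ := exists_hom_pi_range (fibre x B h1) (by
    rintro _ ⟨a, ha, rfl⟩ _ ⟨b, hb, rfl⟩
    rw [← map_mul, ← map_mul, hBcomm a ha b hb])
  replace hψ : Set.range ψ = x.hom '' (B : Set A) := hψ
  have hmsa : IsSelfAdjoint (ψ fun i => ((i : ℕ) : ℂ) + 1) := by
    refine IsSelfAdjoint.map ?_ ψ
    rw [IsSelfAdjoint]
    ext i
    simp
  obtain ⟨h, hhB, hh, hxh⟩ := x.exists_selfAdjoint_hom_eq hmsa (hψ ▸ Set.mem_range_self _)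
  let p : Fin k → A := fun j => cfcₙ (bump j) h
  have hpB : ∀ j, p j ∈ B := fun j => bump_mem hB hhB j
  have hxp : ∀ j, x.hom (p j) = ψ (Pi.single j 1) := by
    intro j
    rw [map_cfcₙ_real _ (continuous_bump j) (bump_zero j) hh, hxh, cfcₙ_bump_hom_pi]
    congr 1
    funext i
    simp only [Pi.single_apply, Fin.ext_iff]
  have hpp : ∀ i j, i ≠ j → p i * p j = 0 := fun i j hij =>
    cfcₙ_bump_mul h (fun h' => hij (Fin.ext h'))
  have hψsum : ∀ l : Fin k → ℂ, ψ l = ∑ j, l j • x.hom (p j) := by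
    intro l
    have : l = ∑ j, l j • (Pi.single j 1 : Fin k → ℂ) := by
      ext i
      simp [Finset.sum_apply, Pi.single_apply]
    conv_lhs => rw [this]
    rw [map_sum]
    simp only [map_smul, hxp]
  obtain ⟨E, hE, -⟩ := hB.expectation
  -- Split `a` as `E a + (a - E a)`: the first part has its value in the span of the projections,
  -- the second is killed by `E`. Spanning at `x` persists nearby.
  have hspan : Submodule.span ℂ (x.hom '' (Set.range p ∪ {a | E a = 0})) = ⊤ := by
    rw [Submodule.eq_top_iff']
    intro m
    obtain ⟨a, rfl⟩ := x.surjective hn hA m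
    obtain ⟨l, hl⟩ : x.hom (E a) ∈ Set.range ψ := hψ ▸ ⟨E a, hE.map_mem a, rfl⟩
    have : x.hom a = ψ l + x.hom (a - E a) := by rw [hl, map_sub]; abel
    rw [this]
    refine Submodule.add_mem _ ?_ (Submodule.subset_span ⟨_, Or.inr ?_, rfl⟩)
    · rw [hψsum]
      exact Submodule.sum_mem _ fun j _ => Submodule.smul_mem _ _
        (Submodule.subset_span ⟨p j, Or.inl ⟨j, rfl⟩, rfl⟩)
    · change E (a - E a) = 0
      rw [map_sub, hE.map_of_mem _ (hE.map_mem a), sub_self]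
  obtain ⟨U₀, hU₀, hxU₀, hidem⟩ := exists_isOpen_bump_idem hn hA x hh (by
    rw [hxh]
    have := cfcₙ_distInt_hom_pi ψ fun i : Fin k => (i : ℕ) + 1
    push_cast at this
    exact this)
  obtain ⟨U₁, hU₁, hxU₁, hspan₁⟩ := exists_isOpen_span_eq_top hn hA x hspan
  have hBspan : ∀ y : Rep θ n, y.base ∈ U₁ → ∀ b ∈ B,
      y.hom b ∈ Submodule.span ℂ (y.hom '' Set.range p) := by
    intro y hy b hb
    have hmem : y.hom b ∈ Submodule.span ℂ (y.hom '' (Set.range p ∪ {a | E a = 0})) := by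
      rw [hspan₁ y hy]; exact Submodule.mem_top
    have himg : ∀ S : Set A, Submodule.span ℂ (y.hom '' S) =
        (Submodule.span ℂ S).map (y.hom : A →ₗ[ℂ] M n) := fun S =>
      (Submodule.map_span (y.hom : A →ₗ[ℂ] M n) S).symm
    rw [himg, Submodule.span_union, Submodule.map_sup, Submodule.mem_sup] at hmem
    obtain ⟨_, ⟨s, hs, rfl⟩, _, ⟨c, hc, rfl⟩, hsum⟩ := hmem
    have hEc : E c = 0 := by
      have : Submodule.span ℂ {a | E a = 0} ≤ LinearMap.ker E :=
        Submodule.span_le.2 fun a ha => ha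
      exact this hc
    have hsB : s ∈ B := by
      have : Submodule.span ℂ (Set.range p) ≤ B.toNonUnitalSubalgebra.toSubmodule :=
        Submodule.span_le.2 (by rintro _ ⟨j, rfl⟩; exact hpB j)
      exact this hs
    -- Since `E` preserves the kernel of `y`, applying it removes `c` and shows that `b` and `s`
    -- agree at `y`.
    have h0 : y.hom (s + c - b) = 0 := by
      rw [map_sub, map_add, sub_eq_zero]; exact hsum
    have h2 := Rep.hom_expectation_eq_zero hn hA hB hE y h0
    rw [map_sub, map_add, hEc, add_zero, hE.map_of_mem s hsB, hE.map_of_mem b hb, map_sub,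
      sub_eq_zero] at h2
    rw [← h2, himg]
    exact ⟨s, hs, rfl⟩
  have hmasa : ∀ m : M n, (∀ b ∈ B, m * x.hom b = x.hom b * m) → m ∈ x.hom '' (B : Set A) := by
    intro m hm
    obtain ⟨X, rfl⟩ := x.surjective hn hA m
    obtain ⟨z, c, hz, -, -, hcx, hcU⟩ :=
      Rep.exists_central_le_one hn hA x (hU₀.inter hU₁) ⟨hxU₀, hxU₁⟩
    -- Compression by the projections makes `w` commute with each of them near `x`, hence with the
    -- nearby fibres of `B`. Cut off by `z`, it commutes with all of `B`; at `x` it still equals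
    -- `m`, which already commutes with the projections.
    let w : A := ∑ j, p j * X * p j
    have hyw : ∀ y : Rep θ n, y.hom (z * w) = (c y.base : ℂ) • y.hom w := fun y => by
      rw [map_mul, hz, smul_mul_assoc, one_mul]
    have hwp : ∀ y : Rep θ n, y.base ∈ U₀ → ∀ l,
        y.hom w * y.hom (p l) = y.hom (p l) * y.hom w := by
      intro y hy l
      have e1 : y.hom w * y.hom (p l) = y.hom (p l * X * p l) := by
        rw [map_sum, Finset.sum_mul, Finset.sum_eq_single l]
        · rw [map_mul, mul_assoc, hidem y hy l]
        · intro j _ hj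
          rw [← map_mul, mul_assoc, hpp j l hj, mul_zero, map_zero]
        · simp
      have e2 : y.hom (p l) * y.hom w = y.hom (p l * X * p l) := by
        rw [map_sum, Finset.mul_sum, Finset.sum_eq_single l]
        · rw [map_mul, map_mul, ← mul_assoc, ← mul_assoc, hidem y hy l]
        · intro j _ hj
          rw [← map_mul, ← mul_assoc, ← mul_assoc, hpp l j hj.symm, zero_mul, zero_mul, map_zero]
        · simp
      rw [e1, e2]
    refine ⟨z * w, (hB.maximalAbelian _).2 fun b hb => ?_, ?_⟩
    · refine Rep.eq_of_forall_hom (θ := θ) hn hA fun y => ?_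
      rw [map_mul y.hom (z * w), map_mul y.hom b, hyw]
      by_cases hy : y.base ∈ U₀ ∩ U₁
      · have hcom : y.hom w * y.hom b = y.hom b * y.hom w := by
          have hmem := hBspan y hy.2 b hb
          generalize y.hom b = m at hmem
          induction hmem using Submodule.span_induction with
          | mem m hm =>
            obtain ⟨_, ⟨l, rfl⟩, rfl⟩ := hm
            exact hwp y hy.1 l
          | zero => simp
          | add _ _ _ _ h₁ h₂ => rw [mul_add, add_mul, h₁, h₂]
          | smul r _ _ h₁ => rw [mul_smul_comm, smul_mul_assoc, h₁]
        rw [smul_mul_assoc, mul_smul_comm, hcom]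
      · simp [hcU _ hy]
    · rw [hyw, hcx, Complex.ofReal_one, one_smul, map_sum]
      have : ∀ j, x.hom (p j * X * p j) = x.hom X * x.hom (p j) := by
        intro j
        rw [map_mul, map_mul, ← hm _ (hpB j), mul_assoc, hidem x hxU₀ j]
      rw [Finset.sum_congr rfl fun j _ => this j, ← Finset.mul_sum]
      have h2 := hψsum 1
      simp only [Pi.one_apply, one_smul] at h2
      rw [← h2, hψ1, mul_one]
  have hherm : (x.hom h).IsHermitian := (hh.map x.hom).star_eq
  -- Diagonalizing `x.hom h` diagonalizes the whole fibre of `B`, since the fibre is spanned by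
  -- spectral projections of `x.hom h`.
  obtain ⟨g, d, hgd⟩ : ∃ (g : M n ≃⋆ₐ[ℂ] M n) (d : Fin n → ℝ),
      g (x.hom h) = Matrix.diagonal fun i => (d i : ℂ) := by
    refine ⟨(Unitary.conjStarAlgAut ℂ _ hherm.eigenvectorUnitary).symm, hherm.eigenvalues, ?_⟩
    rw [StarAlgEquiv.symm_apply_eq]
    exact hherm.spectral_theorem
  have hgp : ∀ j, (g (x.hom (p j))).IsDiag := by
    intro j
    have : g (x.hom (p j)) = cfcₙ (bump j) (g (x.hom h)) :=
      map_cfcₙ_real (x.conj g).hom (continuous_bump j) (bump_zero j) hh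
    rw [this, hgd, cfcₙ_diagonal (continuous_bump j) (bump_zero j)]
    exact Matrix.isDiag_diagonal _
  have hgB : ∀ b ∈ B, (g (x.hom b)).IsDiag := by
    intro b hb
    obtain ⟨l, hl⟩ : x.hom b ∈ Set.range ψ := hψ ▸ ⟨b, hb, rfl⟩
    rw [← hl, hψsum, map_sum]
    intro i i' hii'
    rw [Matrix.sum_apply]
    refine Finset.sum_eq_zero fun j _ => ?_
    rw [map_smul, Matrix.smul_apply, hgp j hii', smul_zero]
  refine ⟨g, ?_⟩
  ext m
  constructor
  · rintro ⟨b, hb, rfl⟩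
    exact hgB b hb
  · intro hm
    obtain ⟨b, hb, hbm⟩ := hmasa (g.symm m) fun b hb => by
      refine EquivLike.injective g ?_
      rw [map_mul, map_mul, StarAlgEquiv.apply_symm_apply,
        ← Matrix.IsDiag.diagonal_diag (hgB b hb), ← Matrix.IsDiag.diagonal_diag hm,
        Matrix.diagonal_mul_diagonal, Matrix.diagonal_mul_diagonal]
      simp only [mul_comm]
    exact ⟨b, hb, by rw [Rep.conj_hom_apply, hbm, StarAlgEquiv.apply_symm_apply]⟩

end Fibres

/-! ### Local triviality -/

section Trivializations

open scoped Matrix.Norms.L2Operator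

variable {A : Type u} [NonUnitalCStarAlgebra A] {T : Type v} [TopologicalSpace T]
  {θ : T ≃ₜ PrimitiveSpectrum A} {n : ℕ} {B : NonUnitalStarSubalgebra ℂ A}

/-- The representation underlying a frame. -/
def Frame.toRep (x : Frame θ n B) : Rep θ n := ⟨x.base, x.hom, x.ker_hom⟩

theorem Frame.smul_hom_apply (g : autMD n) (x : Frame θ n B) (a : A) :
    (g • x).hom a = g.1 (x.hom a) := rfl

theorem Frame.continuous_base : Continuous (Frame.base : Frame θ n B → T) :=
  have h : Continuous fun x : Frame θ n B => (x.base, fun a : A => x.hom a) :=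
    continuous_induced_dom
  continuous_fst.comp h

theorem Frame.continuous_hom_apply (a : A) : Continuous fun x : Frame θ n B => x.hom a :=
  have h : Continuous fun x : Frame θ n B => (x.base, fun a : A => x.hom a) :=
    continuous_induced_dom
  (continuous_apply a).comp (continuous_snd.comp h)

theorem Frame.continuous_iff {X : Type*} [TopologicalSpace X] {f : X → Frame θ n B} :
    Continuous f ↔ Continuous (fun s => (f s).base) ∧ ∀ a, Continuous fun s => (f s).hom a := by
  refine continuous_induced_rng.trans ?_
  refine continuous_prodMk.trans (and_congr Iff.rfl ?_)
  exact continuous_pi_iff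

/-- In coordinates evaluation is a matrix times a vector, so pointwise convergence already gives
joint continuity. -/
theorem continuous_autMD_eval (n : ℕ) : Continuous fun p : autMD n × M n => p.1.1 p.2 := by
  refine continuous_matrix fun i j => ?_
  have h : ∀ p : autMD n × M n, p.1.1 p.2 i j =
      (autMat p.1).mulVec (fun q => p.2 q.1 q.2) (i, j) := fun p => autMD_apply p.1 p.2 (i, j)
  simp only [h]
  have : Continuous fun p : autMD n × M n => (autMat p.1).mulVec fun q => p.2 q.1 q.2 :=
    ((continuous_autMat n).comp continuous_fst).matrix_mulVec
      (continuous_pi fun q => continuous_snd.matrix_elem q.1 q.2)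
  exact (continuous_apply (i, j)).comp this

theorem Frame.exists_base_eq [T2Space T] (hn : 1 ≤ n) (hA : IsHomogeneous A n)
    (hB : IsCartanSubalgebra B) (t : T) : ∃ x : Frame θ n B, x.base = t := by
  obtain ⟨x, rfl⟩ := Rep.exists_base_eq (θ := θ) hn hA t
  obtain ⟨g, hg⟩ := exists_image_eq_diag hn hA hB x
  exact ⟨⟨x.base, (x.conj g).hom, (x.conj g).ker_hom, (x.conj g).surjective hn hA, hg⟩, rfl⟩

/-- Frames over the same point differ by a unique element of `Aut(Mₙ, Dₙ)`. -/
theorem Frame.exists_smul_eq {x y : Frame θ n B} (h : x.base = y.base) :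
    ∃ g : autMD n, g • x = y := by
  obtain ⟨g, hg⟩ := exists_starAlgEquiv_of_ker_eq x.hom y.hom x.surjective y.surjective fun a => by
    rw [← TwoSidedIdeal.mem_ker, ← TwoSidedIdeal.mem_ker, x.ker_hom, y.ker_hom, h]
  have hg' : g '' diag n = diag n := by
    rw [← x.image_eq, Set.image_image, ← y.image_eq.trans x.image_eq.symm]
    simp only [hg]
  refine ⟨⟨g, hg'⟩, ?_⟩
  ext a
  · exact h
  · rw [Frame.smul_hom_apply, hg]

theorem Frame.smul_left_injective (x : Frame θ n B) :
    Function.Injective fun g : autMD n => g • x := by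
  intro g g' h
  apply Subtype.ext
  ext1 m
  obtain ⟨a, rfl⟩ := x.surjective m
  exact congrArg (fun y : Frame θ n B => y.hom a) h

theorem starAlgEquiv_ext_single {g : M n ≃⋆ₐ[ℂ] M n}
    (h : ∀ i j, g (Matrix.single i j 1) = Matrix.single i j 1) (m : M n) : g m = m := by
  rw [Matrix.matrix_eq_sum_single m, map_sum]
  refine Finset.sum_congr rfl fun i _ => ?_
  rw [map_sum]
  refine Finset.sum_congr rfl fun j _ => ?_
  have : Matrix.single i j (m i j) = m i j • (Matrix.single i j 1 : M n) := by simp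
  rw [this, map_smul, h]

/-- Local sections of the bundle of frames, normalized by matrix units in `A`. -/
theorem Frame.exists_local_section [T2Space T] (hn : 1 ≤ n) (hA : IsHomogeneous A n)
    (hB : IsCartanSubalgebra B) (t₀ : T) :
    ∃ (e : Fin n → Fin n → A) (U : Set T) (s : T → Frame θ n B), IsOpen U ∧ t₀ ∈ U ∧
      (∀ t, (s t).base = t) ∧ (∀ t ∈ U, ∀ i j, (s t).hom (e i j) = Matrix.single i j 1) ∧
      ∀ a, ContinuousOn (fun t => (s t).hom a) U := by
  obtain ⟨x, rfl⟩ := Frame.exists_base_eq (θ := θ) hn hA hB t₀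
  obtain ⟨h, hhB, hh, hxh⟩ := x.toRep.exists_selfAdjoint_hom_eq (B := B)
    (m := Matrix.diagonal fun i : Fin n => ((i : ℕ) : ℂ) + 1) (by
      rw [IsSelfAdjoint, Matrix.star_eq_conjTranspose, Matrix.diagonal_conjTranspose]
      congr 1
      funext i
      simp) (by
      change _ ∈ x.hom '' (B : Set A)
      rw [x.image_eq]
      exact Matrix.isDiag_diagonal _)
  obtain ⟨e, U, hU, hxU, he⟩ := exists_local_frame hn hA x.toRep hh hxh
  have hframe : ∀ t, ∃ y : Frame θ n B, y.base = t ∧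
      (t ∈ U → ∀ i j, y.hom (e i j) = Matrix.single i j 1) := by
    intro t
    by_cases ht : t ∈ U
    · obtain ⟨y, hyt, hye, hyp⟩ := he t ht
      refine ⟨⟨t, y.hom, hyt ▸ y.ker_hom, y.surjective hn hA, ?_⟩, rfl, fun _ => hye⟩
      ext m
      constructor
      · rintro ⟨b, hb, rfl⟩ i j hij
        -- The diagonal matrix units are values of elements of `B`, and a matrix commuting with all
        -- of them is diagonal.
        have hc := (hB.maximalAbelian b).1 hb _ (bump_mem hB hhB i)
        have h1 := congrArg y.hom hc
        rw [map_mul, map_mul, hyp] at h1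
        have h2 := congrFun (congrFun h1 i) j
        rw [Matrix.mul_single_apply_of_ne _ _ _ _ _ hij.symm, Matrix.single_mul_apply_same,
          one_mul] at h2
        exact h2.symm
      · intro hm
        refine ⟨∑ i : Fin n, m i i • cfcₙ (bump i) h,
          sum_mem fun i _ => SMulMemClass.smul_mem _ (bump_mem hB hhB i), ?_⟩
        rw [map_sum]
        simp only [map_smul, hyp]
        have : m = Matrix.diagonal m.diag := (Matrix.IsDiag.diagonal_diag hm).symm
        conv_rhs => rw [this, ← Matrix.sum_single_eq_diagonal]
        simp
    · obtain ⟨y, hy⟩ := Frame.exists_base_eq (θ := θ) hn hA hB t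
      exact ⟨y, hy, fun h => absurd h ht⟩
  choose s hs hse using hframe
  refine ⟨e, U, s, hU, hxU, hs, hse, fun a => ?_⟩
  let o : Fin n := ⟨0, hn⟩
  let P : (A → M n) → Prop := fun f => ∀ i j, f (e i j) = Matrix.single i j 1
  have hP : IsClosed {f | P f} := by
    simp only [P, Set.ofPred_forall]
    exact isClosed_iInter fun i => isClosed_iInter fun j =>
      isClosed_eq (continuous_apply _) continuous_const
  have hpos : 0 < ‖(Matrix.single o o 1 : M n)‖ := by
    rw [norm_pos_iff]
    intro h0
    have := congrFun (congrFun h0 o) o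
    simp at this
  -- Representations normalized by the matrix units form a compact set, as `e o o` has fixed nonzero
  -- norm there. An automorphism fixing the matrix units is the identity, so the base map is
  -- injective on `K` and thus a closed embedding; the section is its inverse over `U`, hence
  -- continuous.
  let K : Set (Rep θ n) := {x : Rep θ n | P fun b => x.hom b}
  have hK : IsCompact K := Rep.isCompact_of_isClosed hA (e o o) hpos hP fun f hf => by rw [hf o o]
  have : CompactSpace K := isCompact_iff_compactSpace.1 hK
  have hemb : IsClosedEmbedding fun y : K => y.1.base := by
    refine Continuous.isClosedEmbedding (Rep.continuous_base.comp continuous_subtype_val) ?_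
    rintro ⟨y, hy⟩ ⟨y', hy'⟩ h
    obtain ⟨g, hg⟩ := Rep.exists_equiv hn hA (show y.base = y'.base from h)
    apply Subtype.ext
    ext1
    · exact h
    · ext1 b
      rw [← hg, starAlgEquiv_ext_single]
      intro i j
      have h1 : y.hom (e i j) = Matrix.single i j 1 := hy i j
      have h2 : y'.hom (e i j) = Matrix.single i j 1 := hy' i j
      rw [← h1, hg, h2, h1]
  let σ : U → K := fun t => ⟨(s t).toRep, hse t t.2⟩
  have hσ : Continuous σ := by
    rw [hemb.isInducing.continuous_iff]
    have : (fun y : K => y.1.base) ∘ σ = Subtype.val := funext fun t => hs t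
    rw [this]
    exact continuous_subtype_val
  rw [continuousOn_iff_continuous_domRestrict]
  exact (Rep.continuous_hom_apply a).comp (continuous_subtype_val.comp hσ)

theorem continuousOn_autMD {X : Type*} [TopologicalSpace X] {f : X → autMD n} {S : Set X}
    (hf : ∀ i j, ContinuousOn (fun x => (f x).1 (Matrix.single i j 1)) S) : ContinuousOn f S := by
  rw [continuousOn_iff_continuous_domRestrict]
  refine autMD_continuous_of_autMat (continuous_matrix fun p q => ?_)
  exact (continuousOn_iff_continuous_domRestrict.1 (hf q.1 q.2)).matrix_elem p.1 p.2

/-- The frames of a Cartan subalgebra form a principal bundle. -/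
theorem isPrincipalBundle_frameProj [T2Space T] (hn : 1 ≤ n) (hA : IsHomogeneous A n)
    (θ : T ≃ₜ PrimitiveSpectrum A) (hB : IsCartanSubalgebra B) :
    IsPrincipalBundle (autMD n) (frameProj θ n B) where
  map_smul _ _ := rfl
  locallyTrivial t := by
    obtain ⟨e, U, s, hU, htU, hs, hse, hcont⟩ := Frame.exists_local_section (θ := θ) hn hA hB t
    -- The fibre coordinate of a frame is the unique group element taking the section to it. On `e i
    -- j` its value is that of the frame, which gives continuity.
    choose coord hcoord using fun x : Frame θ n B => Frame.exists_smul_eq (hs x.base)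
    have hcs : ∀ (t : T) (g : autMD n), coord (g • s t) = g := by
      intro t g
      have h1 := hcoord (g • s t)
      have h2 : (g • s t).base = t := hs t
      rw [h2] at h1
      exact Frame.smul_left_injective _ h1
    let τ : Bundle.Trivialization (autMD n) (frameProj θ n B) :=
      { toFun := fun x => (x.base, coord x)
        invFun := fun p => p.2 • s p.1
        source := Frame.base ⁻¹' U
        target := U ×ˢ Set.univ
        map_source' := fun x hx => ⟨hx, trivial⟩
        map_target' := fun p hp => by
          change (s p.1).base ∈ U
          rw [hs]; exact hp.1
        left_inv' := fun x _ => hcoord x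
        right_inv' := fun p _ => by
          ext1
          · exact hs p.1
          · exact hcs p.1 p.2
        open_source := hU.preimage Frame.continuous_base
        open_target := hU.prod isOpen_univ
        continuousOn_toFun := by
          refine Frame.continuous_base.continuousOn.prodMk (continuousOn_autMD fun i j => ?_)
          refine (Frame.continuous_hom_apply (e i j)).continuousOn.congr fun x hx => ?_
          have h1 := congrArg (fun y : Frame θ n B => y.hom (e i j)) (hcoord x)
          simp only [Frame.smul_hom_apply, hse x.base hx] at h1
          exact h1
        continuousOn_invFun := by
          rw [continuousOn_iff_continuous_domRestrict, Frame.continuous_iff]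
          refine ⟨?_, fun a => ?_⟩
          · have : (fun p : (U ×ˢ Set.univ : Set (T × autMD n)) =>
                ((U ×ˢ Set.univ).domRestrict (fun p : T × autMD n => p.2 • s p.1) p).base) =
                fun p => p.1.1 := funext fun p => hs p.1.1
            rw [this]
            exact continuous_fst.comp continuous_subtype_val
          · have h1 : Continuous fun p : (U ×ˢ Set.univ : Set (T × autMD n)) =>
                (s p.1.1).hom a :=
              (hcont a).comp_continuous (continuous_fst.comp continuous_subtype_val)
                fun p => p.2.1
            exact (continuous_autMD_eval n).comp
              ((continuous_snd.comp continuous_subtype_val).prodMk h1)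
        baseSet := U
        open_baseSet := hU
        source_eq := rfl
        target_eq := rfl
        proj_toFun := fun _ _ => rfl }
    refine ⟨τ, htU, fun g x _ => ?_⟩
    change coord (g • x) = g * coord x
    conv_lhs => rw [← hcoord x, smul_smul]
    exact hcs _ _

end Trivializations

/-! ### Isomorphisms of pairs and isomorphisms of bundles -/

section Transport

variable {A : Type u} [NonUnitalCStarAlgebra A] {T : Type v} [TopologicalSpace T]
  {θ : T ≃ₜ PrimitiveSpectrum A} {n : ℕ} {B₁ B₂ : NonUnitalStarSubalgebra ℂ A}

theorem IsPrimitiveIdeal.exists_comap {I : TwoSidedIdeal A} (hI : IsPrimitiveIdeal I)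
    (Φ : A ≃⋆ₐ[ℂ] A) : ∃ J, IsPrimitiveIdeal J ∧ ∀ a, a ∈ J ↔ Φ a ∈ I := by
  obtain ⟨H, i1, i2, i3, π, hπ, rfl⟩ := hI
  let ρ : A →⋆ₙₐ[ℂ] (H →L[ℂ] H) := π.comp Φ.toNonUnitalStarAlgHom
  have hρ : ∀ a, ρ a = π (Φ a) := fun _ => rfl
  have hρ' : ∀ a, π a = ρ (Φ.symm a) := fun a => by rw [hρ, Φ.apply_symm_apply]
  refine ⟨TwoSidedIdeal.ker ρ, ⟨H, i1, i2, i3, ρ, ⟨fun h => hπ.ne_zero ?_, fun K hK h => ?_⟩, rfl⟩,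
    fun a => ?_⟩
  · ext1 a
    rw [hρ', h]
    rfl
  · exact hπ.eq_bot_or_eq_top K hK fun a v hv => by
      rw [hρ']
      exact h _ v hv
  · rw [TwoSidedIdeal.mem_ker, TwoSidedIdeal.mem_ker, hρ]

theorem exists_continuous_comap (θ : T ≃ₜ PrimitiveSpectrum A) (Φ : A ≃⋆ₐ[ℂ] A) :
    ∃ f : T → T, Continuous f ∧ ∀ t a, a ∈ (θ (f t)).1 ↔ Φ a ∈ (θ t).1 := by
  have hex : ∀ t, ∃ u, ∀ a, a ∈ (θ u).1 ↔ Φ a ∈ (θ t).1 := by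
    intro t
    obtain ⟨J, hJ, h⟩ := IsPrimitiveIdeal.exists_comap (θ t).2 Φ
    obtain ⟨u, rfl⟩ := exists_eq_of_isPrimitiveIdeal θ hJ
    exact ⟨u, h⟩
  choose f hf using hex
  refine ⟨f, ?_, hf⟩
  have : Continuous fun t => θ (f t) := by
    rw [continuous_generateFrom_iff]
    rintro _ ⟨a, rfl⟩
    have : (fun t => θ (f t)) ⁻¹' {P : PrimitiveSpectrum A | a ∉ P.1} =
        {t | Φ a ∉ (θ t).1} := by
      ext t
      exact not_congr (hf t a)
    rw [this]
    exact Rep.isOpen_notMem θ _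
  simpa [Function.comp_def] using θ.symm.continuous.comp this

theorem eq_of_mem_iff (θ : T ≃ₜ PrimitiveSpectrum A) {s t : T}
    (h : ∀ a, a ∈ (θ s).1 ↔ a ∈ (θ t).1) : s = t :=
  θ.injective (Subtype.ext (TwoSidedIdeal.ext h))

/-- The homeomorphism of the spectrum induced by an automorphism. -/
theorem exists_homeomorph_comap (θ : T ≃ₜ PrimitiveSpectrum A) (Φ : A ≃⋆ₐ[ℂ] A) :
    ∃ f : T ≃ₜ T, ∀ t a, a ∈ (θ (f t)).1 ↔ Φ a ∈ (θ t).1 := by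
  obtain ⟨f, hf, hfa⟩ := exists_continuous_comap θ Φ
  obtain ⟨g, hg, hga⟩ := exists_continuous_comap θ Φ.symm
  exact ⟨{  toFun := f
            invFun := g
            left_inv := fun t => eq_of_mem_iff θ fun a => by
              rw [hga, hfa, Φ.apply_symm_apply]
            right_inv := fun t => eq_of_mem_iff θ fun a => by
              rw [hfa, hga, Φ.symm_apply_apply]
            continuous_toFun := hf
            continuous_invFun := hg }, hfa⟩

/-- Composition of a frame with an automorphism. -/
def Frame.comap (Φ : A ≃⋆ₐ[ℂ] A) (hΦ : Φ '' (B₂ : Set A) = B₁) (f : T → T)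
    (hf : ∀ t a, a ∈ (θ (f t)).1 ↔ Φ a ∈ (θ t).1) (x : Frame θ n B₁) : Frame θ n B₂ where
  base := f x.base
  hom := x.hom.comp Φ.toNonUnitalStarAlgHom
  ker_hom := by
    ext a
    rw [hf, ← x.ker_hom, TwoSidedIdeal.mem_ker, TwoSidedIdeal.mem_ker]
    rfl
  surjective := x.surjective.comp (EquivLike.surjective Φ)
  image_eq := by
    rw [← x.image_eq, ← hΦ, Set.image_image]
    rfl

theorem Frame.continuous_comap {Φ : A ≃⋆ₐ[ℂ] A} {hΦ : Φ '' (B₂ : Set A) = B₁} {f : T → T}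
    (hfc : Continuous f) {hf : ∀ t a, a ∈ (θ (f t)).1 ↔ Φ a ∈ (θ t).1} :
    Continuous (Frame.comap (n := n) Φ hΦ f hf) :=
  Frame.continuous_iff.2
    ⟨hfc.comp Frame.continuous_base, fun a => Frame.continuous_hom_apply (Φ a)⟩

/-- A frame of `B₁` composed with `Φ⁻¹` is a frame of `B₂`. This commutes with the action, which
composes on the other side. -/
theorem PairIso.principalBundleIso (θ : T ≃ₜ PrimitiveSpectrum A) (n : ℕ) (h : PairIso B₁ B₂) :
    PrincipalBundleIso (autMD n) (frameProj θ n B₁) (frameProj θ n B₂) := by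
  obtain ⟨Φ, hΦ⟩ := h
  have hΦ' : Φ.symm '' (B₂ : Set A) = B₁ := by
    rw [← hΦ, Set.image_image]
    simp
  obtain ⟨f, hf⟩ := exists_homeomorph_comap θ Φ.symm
  have hf' : ∀ t a, a ∈ (θ (f.symm t)).1 ↔ Φ a ∈ (θ t).1 := by
    intro t a
    conv_rhs => rw [← f.apply_symm_apply t, hf, Φ.symm_apply_apply]
  refine ⟨{ toFun := Frame.comap Φ.symm hΦ' f hf
            invFun := Frame.comap Φ hΦ f.symm hf'
            left_inv := fun x => ?_
            right_inv := fun x => ?_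
            continuous_toFun := Frame.continuous_comap f.continuous
            continuous_invFun := Frame.continuous_comap f.symm.continuous }, f,
    fun _ => rfl, fun _ _ => rfl⟩
  · ext1
    · exact f.symm_apply_apply _
    · ext1 a
      exact congrArg x.hom (Φ.symm_apply_apply a)
  · ext1
    · exact f.apply_symm_apply _
    · ext1 a
      exact congrArg x.hom (Φ.apply_symm_apply a)

end Transport

/-! ### Recovering the automorphism from a bundle isomorphism -/

section Reconstruction

open scoped Matrix.Norms.L2Operator

variable {A : Type u} [NonUnitalCStarAlgebra A] {T : Type v} [TopologicalSpace T] [T2Space T]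
  {θ : T ≃ₜ PrimitiveSpectrum A} {n : ℕ} {B B₁ B₂ : NonUnitalStarSubalgebra ℂ A}

theorem Frame.norm_le_of_forall_hom (hn : 1 ≤ n) (hA : IsHomogeneous A n)
    (hB : IsCartanSubalgebra B) {a : A} {c : ℝ} (hc : 0 ≤ c)
    (h : ∀ x : Frame θ n B, ‖x.hom a‖ ≤ c) : ‖a‖ ≤ c := by
  refine Rep.norm_le_of_forall_hom (θ := θ) hn hA hc fun x => ?_
  obtain ⟨y, hy⟩ := Frame.exists_base_eq (θ := θ) hn hA hB x.base
  rw [← Rep.norm_eq hn hA (x := y.toRep) hy]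
  exact h y

theorem Frame.eq_of_forall_hom (hn : 1 ≤ n) (hA : IsHomogeneous A n)
    (hB : IsCartanSubalgebra B) {a b : A} (h : ∀ x : Frame θ n B, x.hom a = x.hom b) : a = b := by
  rw [← sub_eq_zero, ← norm_le_zero_iff]
  exact Frame.norm_le_of_forall_hom (θ := θ) hn hA hB le_rfl fun x => by
    rw [map_sub, h, sub_self, norm_zero]

/-- An element diagonal in all frames commutes with `B` in each of them, hence commutes with `B`,
and maximality applies. -/
theorem Frame.mem_iff (hn : 1 ≤ n) (hA : IsHomogeneous A n) (hB : IsCartanSubalgebra B)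
    (θ : T ≃ₜ PrimitiveSpectrum A) (a : A) :
    a ∈ B ↔ ∀ x : Frame θ n B, x.hom a ∈ diag n := by
  constructor
  · intro ha x
    rw [← x.image_eq]
    exact ⟨a, ha, rfl⟩
  · intro h
    refine (hB.maximalAbelian a).2 fun b hb => ?_
    refine Frame.eq_of_forall_hom (θ := θ) hn hA hB fun x => ?_
    have hbx : x.hom b ∈ diag n := by
      rw [← x.image_eq]
      exact ⟨b, hb, rfl⟩
    rw [map_mul, map_mul, ← Matrix.IsDiag.diagonal_diag (h x), ← Matrix.IsDiag.diagonal_diag hbx,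
      Matrix.diagonal_mul_diagonal, Matrix.diagonal_mul_diagonal]
    simp only [mul_comm]

/-- Local triviality makes the projection locally a product projection. -/
theorem Frame.isOpenMap_base (hn : 1 ≤ n) (hA : IsHomogeneous A n) (hB : IsCartanSubalgebra B) :
    IsOpenMap (Frame.base : Frame θ n B → T) := by
  rw [isOpenMap_iff_nhds_le]
  intro x
  obtain ⟨e, he, -⟩ := (isPrincipalBundle_frameProj hn hA θ hB).locallyTrivial x.base
  exact (e.map_proj_nhds (e.mem_source.2 he)).ge

variable {G : Frame θ n B₂ → Frame θ n B₁} {g : T ≃ₜ T}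

/-- An element of `A` agrees approximately with the continuous section that an equivariant map of
frames makes of a given element. -/
theorem Frame.exists_norm_hom_sub_le (hn : 1 ≤ n) (hA : IsHomogeneous A n)
    (hB₂ : IsCartanSubalgebra B₂) (hG : Continuous G) (hg : ∀ y, (G y).base = g y.base)
    (hsmul : ∀ (h : autMD n) y, G (h • y) = h • G y) (a : A) {ε : ℝ} (hε : 0 < ε) :
    ∃ b : A, ∀ y : Frame θ n B₂, ‖y.hom b - (G y).hom a‖ ≤ ε + ε := by
  -- Equivariance makes the error depend only on the base point, so it can be controlled on open
  -- subsets of `T`.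
  have hinv : ∀ (b : A) (y y' : Frame θ n B₂), y.base = y'.base →
      ‖y.hom b - (G y).hom a‖ = ‖y'.hom b - (G y').hom a‖ := by
    intro b y y' h
    obtain ⟨k, rfl⟩ := Frame.exists_smul_eq h
    rw [hsmul, Frame.smul_hom_apply, Frame.smul_hom_apply, ← map_sub, StarAlgEquiv.norm_map]
  choose y₀ hy₀ using Frame.exists_base_eq (θ := θ) hn hA hB₂
  choose b hb using fun t => (y₀ t).surjective ((G (y₀ t)).hom a)
  let V : T → Set T := fun t => Frame.base '' {y : Frame θ n B₂ | ‖y.hom (b t) - (G y).hom a‖ < ε}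
  have hV : ∀ t, IsOpen (V t) := fun t => by
    refine Frame.isOpenMap_base hn hA hB₂ _ (isOpen_lt ?_ continuous_const)
    exact ((Frame.continuous_hom_apply _).sub ((Frame.continuous_hom_apply a).comp hG)).norm
  have hVt : ∀ t, t ∈ V t := fun t => ⟨y₀ t, by
    change ‖_‖ < ε
    rwa [hb, sub_self, norm_zero], hy₀ t⟩
  -- Outside this compact set the section has norm below `ε`, so there any combination with total
  -- weight at most `1` is good enough.
  let K : Set T := g.symm '' (Rep.base '' {x : Rep θ n | ε ≤ ‖x.hom a‖})
  have hK : IsCompact K :=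
    ((Rep.isCompact_le_norm hA a hε).image Rep.continuous_base).image g.symm.continuous
  obtain ⟨s, z, c, -, hz, hc0, hcV, hc1, hcK⟩ :=
    Rep.exists_partition hn hA θ hK (fun t _ => hV t) fun t _ => hVt t
  refine ⟨∑ t ∈ s, z t * b t, fun y => ?_⟩
  -- The first sum is the local approximation error; the second term is the missing weight, which
  -- vanishes on `K`. Each contributes at most `ε`.
  have hsum : y.hom (∑ t ∈ s, z t * b t) - (G y).hom a =
      ∑ t ∈ s, (c t y.base : ℂ) • (y.hom (b t) - (G y).hom a) -
        ((1 - ∑ t ∈ s, c t y.base : ℝ) : ℂ) • (G y).hom a := by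
    have h1 : ∀ t ∈ s, y.hom (z t * b t) = (c t y.base : ℂ) • y.hom (b t) := by
      intro t ht
      have : y.hom (z t) = (c t y.base : ℂ) • (1 : M n) := hz t ht y.toRep
      rw [map_mul, this, smul_mul_assoc, one_mul]
    rw [map_sum, Finset.sum_congr rfl h1]
    simp only [smul_sub, Finset.sum_sub_distrib, ← Finset.sum_smul]
    push_cast
    rw [sub_smul, one_smul]
    abel
  have hnorm : ∀ {r : ℝ}, 0 ≤ r → ‖(r : ℂ)‖ = r := fun h => by
    rw [Complex.norm_real, Real.norm_of_nonneg h]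
  have h1 : ‖∑ t ∈ s, (c t y.base : ℂ) • (y.hom (b t) - (G y).hom a)‖ ≤ ε := by
    calc _ ≤ ∑ t ∈ s, c t y.base * ε := norm_sum_le_of_le _ fun t ht => by
            rw [norm_smul, hnorm (hc0 t ht _)]
            by_cases hy : y.base ∈ V t
            · obtain ⟨y', hy', h⟩ := hy
              rw [hinv _ _ _ h.symm]
              exact mul_le_mul_of_nonneg_left (le_of_lt hy') (hc0 t ht _)
            · rw [hcV t ht _ hy, zero_mul, zero_mul]
      _ = (∑ t ∈ s, c t y.base) * ε := (Finset.sum_mul _ _ _).symm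
      _ ≤ 1 * ε := mul_le_mul_of_nonneg_right (hc1 _) hε.le
      _ = ε := one_mul ε
  have h2 : ‖((1 - ∑ t ∈ s, c t y.base : ℝ) : ℂ) • (G y).hom a‖ ≤ ε := by
    rw [norm_smul, hnorm (sub_nonneg.2 (hc1 _))]
    by_cases hy : y.base ∈ K
    · rw [hcK _ hy, sub_self, zero_mul]
      exact hε.le
    · have hlt : ‖(G y).hom a‖ ≤ ε := by
        refine le_of_not_ge fun h => hy ?_
        refine ⟨(G y).base, ⟨(G y).toRep, h, rfl⟩, ?_⟩
        rw [hg, g.symm_apply_apply]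
      have h0 : 0 ≤ ∑ t ∈ s, c t y.base := Finset.sum_nonneg fun t ht => hc0 t ht _
      calc _ ≤ 1 * ε := mul_le_mul (by linarith) hlt (norm_nonneg _) zero_le_one
        _ = ε := one_mul ε
  rw [hsum]
  exact (norm_sub_le _ _).trans (add_le_add h1 h2)

/-- Approximations with errors `2 · 2⁻ᵏ` form a Cauchy sequence, because the norm of `A` is
controlled by frames; its limit is the required element. -/
theorem Frame.exists_hom_eq_comp (hn : 1 ≤ n) (hA : IsHomogeneous A n)
    (hB₂ : IsCartanSubalgebra B₂) (hG : Continuous G) (hg : ∀ y, (G y).base = g y.base)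
    (hsmul : ∀ (h : autMD n) y, G (h • y) = h • G y) (a : A) :
    ∃ b : A, ∀ y : Frame θ n B₂, y.hom b = (G y).hom a := by
  have hδ : ∀ k : ℕ, (0 : ℝ) < (1 / 2) ^ k := fun k => by positivity
  choose b hb using fun k => Frame.exists_norm_hom_sub_le hn hA hB₂ hG hg hsmul a (hδ k)
  have hcauchy : CauchySeq b := by
    -- Consecutive errors add up to `3 · 2⁻ᵏ`, so the constant `4` leaves room.
    refine cauchySeq_of_le_geometric (1 / 2) 4 (by norm_num) fun k => ?_
    rw [dist_eq_norm]
    refine Frame.norm_le_of_forall_hom (θ := θ) hn hA hB₂ (mul_nonneg (by norm_num) (hδ k).le)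
      fun y => ?_
    have h1 := hb k y
    have h2 := hb (k + 1) y
    have h3 : y.hom (b k - b (k + 1)) =
        (y.hom (b k) - (G y).hom a) - (y.hom (b (k + 1)) - (G y).hom a) := by
      rw [map_sub]; abel
    rw [h3]
    refine (norm_sub_le _ _).trans ?_
    rw [pow_succ] at h2
    linarith [hδ k]
  obtain ⟨b', hb'⟩ := cauchySeq_tendsto_of_complete hcauchy
  refine ⟨b', fun y => ?_⟩
  have hlim : Filter.Tendsto (fun k => y.hom (b k)) Filter.atTop (𝓝 (y.hom b')) := by
    rw [tendsto_iff_norm_sub_tendsto_zero] at hb' ⊢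
    refine squeeze_zero (fun _ => norm_nonneg _) (fun k => ?_) hb'
    rw [← map_sub]
    exact NonUnitalStarAlgHom.norm_apply_le y.hom _
  refine tendsto_nhds_unique hlim ?_
  rw [tendsto_iff_norm_sub_tendsto_zero]
  refine squeeze_zero (fun _ => norm_nonneg _) (fun k => hb k y) ?_
  have : Filter.Tendsto (fun k : ℕ => (1 / 2 : ℝ) ^ k) Filter.atTop (𝓝 0) :=
    tendsto_pow_atTop_nhds_zero_of_lt_one (by norm_num) (by norm_num)
  simpa using this.add this

/-- The endomorphism of `A` induced by an equivariant map of frames. -/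
theorem Frame.exists_starAlgHom_hom_eq_comp (hn : 1 ≤ n) (hA : IsHomogeneous A n)
    (hB₂ : IsCartanSubalgebra B₂) (hG : Continuous G) (hg : ∀ y, (G y).base = g y.base)
    (hsmul : ∀ (h : autMD n) y, G (h • y) = h • G y) :
    ∃ Φ : A →⋆ₙₐ[ℂ] A, ∀ a (y : Frame θ n B₂), y.hom (Φ a) = (G y).hom a := by
  choose Φ hΦ using Frame.exists_hom_eq_comp hn hA hB₂ hG hg hsmul
  have heq {a b : A} (h : ∀ x : Frame θ n B₂, x.hom a = x.hom b) : a = b :=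
    Frame.eq_of_forall_hom hn hA hB₂ h
  exact ⟨{  toFun := Φ
            map_smul' := fun c a => heq fun y => by
              rw [hΦ, map_smul, MonoidHom.id_apply, map_smul, hΦ]
            map_zero' := heq fun y => by rw [hΦ, map_zero, map_zero]
            map_add' := fun a b => heq fun y => by rw [hΦ, map_add, map_add, hΦ, hΦ]
            map_mul' := fun a b => heq fun y => by rw [hΦ, map_mul, map_mul, hΦ, hΦ]
            map_star' := fun a => heq fun y => by rw [hΦ, map_star, map_star, hΦ] }, hΦ⟩

/-- `F⁻¹` and `F` induce endomorphisms of `A` that are mutually inverse in every frame. `F` matches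
the frames of `B₁` with those of `B₂`, so being diagonal in all of them is preserved. -/
theorem PrincipalBundleIso.pairIso (hn : 1 ≤ n) (hA : IsHomogeneous A n)
    (hB₁ : IsCartanSubalgebra B₁) (hB₂ : IsCartanSubalgebra B₂)
    (h : PrincipalBundleIso (autMD n) (frameProj θ n B₁) (frameProj θ n B₂)) :
    PairIso B₁ B₂ := by
  obtain ⟨F, f, hf, hF⟩ := h
  have hf' : ∀ y, (F.symm y).base = f.symm y.base := fun y => by
    have : (F (F.symm y)).base = f (F.symm y).base := hf (F.symm y)
    rw [F.apply_symm_apply] at this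
    rw [this, f.symm_apply_apply]
  have hF' : ∀ (k : autMD n) y, F.symm (k • y) = k • F.symm y := fun k y => by
    rw [F.symm_apply_eq, hF, F.apply_symm_apply]
  obtain ⟨Φ, hΦ⟩ := Frame.exists_starAlgHom_hom_eq_comp hn hA hB₂ F.symm.continuous hf' hF'
  obtain ⟨Ψ, hΨ⟩ := Frame.exists_starAlgHom_hom_eq_comp hn hA hB₁ F.continuous hf hF
  have h1 : ∀ a, Ψ (Φ a) = a := fun a => Frame.eq_of_forall_hom (θ := θ) hn hA hB₁ fun x => by
    rw [hΨ, hΦ, F.symm_apply_apply]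
  have h2 : ∀ a, Φ (Ψ a) = a := fun a => Frame.eq_of_forall_hom (θ := θ) hn hA hB₂ fun x => by
    rw [hΦ, hΨ, F.apply_symm_apply]
  have hmem : ∀ a, Φ a ∈ B₂ ↔ a ∈ B₁ := by
    intro a
    rw [Frame.mem_iff hn hA hB₁ θ, Frame.mem_iff hn hA hB₂ θ]
    constructor
    · intro h x
      have := h (F x)
      rwa [hΦ, F.symm_apply_apply] at this
    · intro h y
      rw [hΦ]
      exact h _
  refine ⟨StarAlgEquiv.ofBijective Φ ⟨Function.LeftInverse.injective h1,
    Function.RightInverse.surjective h2⟩, ?_⟩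
  ext b
  constructor
  · rintro ⟨a, ha, rfl⟩
    exact (hmem a).2 ha
  · intro hb
    exact ⟨Ψ b, (hmem _).1 ((h2 b).symm ▸ hb), h2 b⟩

end Reconstruction

end HomCartan

end

theorem proposition2p3 {A : Type u} [NonUnitalCStarAlgebra A]
    {T : Type v} [TopologicalSpace T] [T2Space T] [LocallyCompactSpace T]
    {n : ℕ} (hn : 1 ≤ n) (hA : HomCartan.IsHomogeneous A n)
    (θ : T ≃ₜ HomCartan.PrimitiveSpectrum A)
    (B₁ B₂ : NonUnitalStarSubalgebra ℂ A)
    (hB₁ : HomCartan.IsCartanSubalgebra B₁) (hB₂ : HomCartan.IsCartanSubalgebra B₂) :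
    HomCartan.IsPrincipalBundle (HomCartan.autMD n) (HomCartan.frameProj θ n B₁) ∧
    HomCartan.IsPrincipalBundle (HomCartan.autMD n) (HomCartan.frameProj θ n B₂) ∧
    (HomCartan.PairIso B₁ B₂ ↔
      HomCartan.PrincipalBundleIso (HomCartan.autMD n)
        (HomCartan.frameProj θ n B₁) (HomCartan.frameProj θ n B₂)) := by
  exact ⟨HomCartan.isPrincipalBundle_frameProj hn hA θ hB₁,
    HomCartan.isPrincipalBundle_frameProj hn hA θ hB₂,
    fun h => h.principalBundleIso θ n, fun h => h.pairIso hn hA hB₁ hB₂⟩
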